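/- Let $1<r\le p<\infty$ and $1<q<\infty$, and write $s'=s/(s-1)$. Let $\sigma,w$ be weights on $\mathbb R^d$ (locally integrable, positive a.e.; $\sigma(Q)=\int_Q\sigma$, $w(Q)=\int_Q w$), let $\mathcal D$ be a dyadic grid in $\mathbb R^d$, $\mathcal Q\subseteq\mathcal D$ any collection of its cubes, and $\tau=\{\tau_R\}_{R\in\mathcal Q}$ nonnegative constants. With $\mathbb E_R(g)=|R|^{-1}\int_R g$, put $$\overline T(f\sigma)=\Big(\sum_{R\in\mathcal Q}\big|\tau_R\,\mathbb E_R(f\sigma)\mathbf 1_R\big|^q\Big)^{1/q},\qquad U(\{h_R\}_{R\in\mathcal Q})=\sum_{R\in\mathcal Q}\tau_R\,\mathbb E_R(h_R)\mathbf 1_R .$$ Let $B$ be the class of sequences of measurable functions $\{a_R\}_{R\in\mathcal Q}$ such that each $a_R$ vanishes off $R$ and $\big(\sum_{R\in\mathcal Q}|a_R(x)|^{q'}\big)^{1/q'}=1$ for almost every $x\in\bigcup_{R\in\mathcal Q}R$. Define, in $[0,\infty]$, $$\mathcal L=\sup_{Q\in\mathcal D}\ \sup_{\{a_R\}\in B}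 w(Q)^{-r'/p'}\int_Q\big|U(\{\mathbf 1_{Q\cap R}\,a_R\,w\}_{R\in\mathcal Q})\big|^{r'}\sigma,\qquad \mathcal L_*=\sup_{Q\in\mathcal D}\sigma(Q)^{-p/r}\int_Q\overline T(\mathbf 1_Q\sigma)^p\,w ,$$ where $|U(\cdot)|$ is given the value $\infty$ at points where the series does not converge absolutely. Then $\overline T(\cdot\,\sigma)$ is bounded from $L^r(\sigma)$ to $L^p(w)$ if and only if $\mathcal L<\infty$ and $\mathcal L_*<\infty$. Moreover there is a constant $K>0$ depending only on $d,r,p,q$ such that $$K^{-1}\max\{\mathcal L^{1/r'},\mathcal L_*^{1/p}\}\le\|\overline T(\cdot\,\sigma)\|_{L^r(\sigma)\to L^p(w)}\le K\max\{\mathcal L^{1/r'},\mathcal L_*^{1/p}\}.$$ -/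

import Mathlib

open MeasureTheory Set
open scoped ENNReal NNReal

noncomputable section

namespace VectorDyadic

/-- `Q` is a half-open cube `∏ᵢ [aᵢ, aᵢ + ℓ)` in `ℝᵈ`, of side length `ℓ`. -/
def IsCube {d : ℕ} (l : ℝ) (Q : Set (Fin d → ℝ)) : Prop :=
  ∃ a : Fin d → ℝ, Q = {x | ∀ i, a i ≤ x i ∧ x i < a i + l}

/-- A dyadic grid in `ℝᵈ`: a family of half-open cubes whose side lengths are integer powers of
two, any two of which are nested or disjoint, such that for every `k : ℤ` the cubes of side
length `2 ^ k` cover `ℝᵈ` (and hence partition it). -/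
structure IsDyadicGrid {d : ℕ} (D : Set (Set (Fin d → ℝ))) : Prop where
  isCube : ∀ Q ∈ D, ∃ k : ℤ, IsCube ((2 : ℝ) ^ k) Q
  nested : ∀ Q ∈ D, ∀ R ∈ D, Q ⊆ R ∨ R ⊆ Q ∨ Disjoint Q R
  cover : ∀ (k : ℤ) (x : Fin d → ℝ), ∃ Q ∈ D, IsCube ((2 : ℝ) ^ k) Q ∧ x ∈ Q

/-- A weight on `ℝᵈ`: a locally integrable function that is positive almost everywhere. -/
structure IsWeight {d : ℕ} (ω : (Fin d → ℝ) → ℝ) : Prop where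
  locallyIntegrable : LocallyIntegrable ω volume
  pos : ∀ᵐ x, 0 < ω x

/-- The measure `ω dx` attached to a weight `ω`. -/
def wMeasure {d : ℕ} (ω : (Fin d → ℝ) → ℝ) : Measure (Fin d → ℝ) :=
  volume.withDensity (fun x => ENNReal.ofReal (ω x))

/-- The Lebesgue average `𝔼_Q g = |Q|⁻¹ ∫_Q g`. -/
def avg {d : ℕ} (Q : Set (Fin d → ℝ)) (g : (Fin d → ℝ) → ℝ) : ℝ :=
  (volume.real Q)⁻¹ * ∫ x in Q, g x

variable {d : ℕ} {𝒬 : Set (Set (Fin d → ℝ))}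

/-- The operator `T̄(fσ)(x) = (∑_{R ∈ 𝒬} |τ_R 𝔼_R(fσ) 1_R(x)|^q)^{1/q}`, with values
in `[0, ∞]`. -/
def Tbar (q : ℝ) (τ : 𝒬 → ℝ≥0) (σ f : (Fin d → ℝ) → ℝ) (x : Fin d → ℝ) : ℝ≥0∞ :=
  (∑' R : 𝒬, ‖(R : Set (Fin d → ℝ)).indicator
    (fun _ => (τ R : ℝ) * avg (R : Set (Fin d → ℝ)) (fun y => f y * σ y)) x‖ₑ ^ q) ^ (1 / q)

open Classical in
/-- The absolute value `|U({h_R})(x)| = |∑_{R ∈ 𝒬} 𝔼_R(h_R) τ_R 1_R(x)|`, with the value `∞` at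
the points where the series does not converge (absolutely). -/
def absU (τ : 𝒬 → ℝ≥0) (h : 𝒬 → (Fin d → ℝ) → ℝ) (x : Fin d → ℝ) : ℝ≥0∞ :=
  if Summable (fun R : 𝒬 => (R : Set (Fin d → ℝ)).indicator
      (fun _ => avg (R : Set (Fin d → ℝ)) (h R) * (τ R : ℝ)) x)
  then ‖∑' R : 𝒬, (R : Set (Fin d → ℝ)).indicator
      (fun _ => avg (R : Set (Fin d → ℝ)) (h R) * (τ R : ℝ)) x‖ₑ
  else ∞

/-- The class `B` (for the exponent `s = q'`): sequences of measurable functions `{a_R}`, each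
`a_R` vanishing off `R`, whose `ℓ^s` norm is `1` at almost every point of `⋃_{R ∈ 𝒬} R`
(elsewhere all the `a_R` vanish). -/
structure MemB (s : ℝ) (a : 𝒬 → (Fin d → ℝ) → ℝ) : Prop where
  aemeasurable : ∀ R, AEMeasurable (a R) volume
  norm_eq_one : ∀ᵐ x, x ∈ ⋃₀ 𝒬 → (∑' R : 𝒬, ‖a R x‖ₑ ^ s) ^ (1 / s) = 1
  support_subset : ∀ R : 𝒬, Function.support (a R) ⊆ (R : Set (Fin d → ℝ))

/-- `C` is an admissible constant in `‖T̄(fσ)‖_{L^p(w)} ≤ C ‖f‖_{L^r(σ)}`. -/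
def BoundedBy (r p q : ℝ) (τ : 𝒬 → ℝ≥0) (σ w : (Fin d → ℝ) → ℝ) (C : ℝ≥0∞) : Prop :=
  ∀ f : (Fin d → ℝ) → ℝ, MemLp f (ENNReal.ofReal r) (wMeasure σ) →
    eLpNorm (Tbar q τ σ f) (ENNReal.ofReal p) (wMeasure w) ≤
      C * eLpNorm f (ENNReal.ofReal r) (wMeasure σ)

/-- `T̄(·σ)` is bounded from `L^r(σ)` to `L^p(w)`. -/
def IsBoundedOp (r p q : ℝ) (τ : 𝒬 → ℝ≥0) (σ w : (Fin d → ℝ) → ℝ) : Prop :=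
  ∃ C : ℝ≥0, BoundedBy r p q τ σ w C

/-- The operator norm of `T̄(·σ) : L^r(σ) → L^p(w)`, which is `∞` when it is unbounded. -/
def opNorm (r p q : ℝ) (τ : 𝒬 → ℝ≥0) (σ w : (Fin d → ℝ) → ℝ) : ℝ≥0∞ :=
  sInf {C : ℝ≥0∞ | BoundedBy r p q τ σ w C}

/-- The testing constant `𝓛_*` for `T̄`. -/
def directTesting (r p q : ℝ) (D : Set (Set (Fin d → ℝ))) (τ : 𝒬 → ℝ≥0)
    (σ w : (Fin d → ℝ) → ℝ) : ℝ≥0∞ :=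
  ⨆ Q ∈ D, wMeasure σ Q ^ (-(p / r)) *
    ∫⁻ x in Q, Tbar q τ σ (Q.indicator fun _ => 1) x ^ p ∂(wMeasure w)

/-- The testing constant `𝓛` for the dual operator `U`; `r'`, `p'`, `q'` are the conjugate
exponents. -/
def dualTesting (r p q : ℝ) (D : Set (Set (Fin d → ℝ))) (τ : 𝒬 → ℝ≥0)
    (σ w : (Fin d → ℝ) → ℝ) : ℝ≥0∞ :=
  ⨆ Q ∈ D, ⨆ a ∈ {a : 𝒬 → (Fin d → ℝ) → ℝ | MemB q.conjExponent a},
    wMeasure w Q ^ (-(r.conjExponent / p.conjExponent)) *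
      ∫⁻ x in Q, absU τ (fun R => (Q ∩ (R : Set (Fin d → ℝ))).indicator fun y => a R y * w y) x
        ^ r.conjExponent ∂(wMeasure σ)

end VectorDyadic

end

/-!
Necessity: test the bound on `𝟏_Q`, and on the extremal function in the duality between `L^r` and
`L^{r'}` for `U`.

Sufficiency reduces to finite subfamilies of `𝒬`. There `T̄(fσ)` is the maximal function of the
`ℓ^q` norms of `τ_R 𝔼_R(fσ)` along the cubes above a given one, so `{T̄(fσ) > 2^k}` is the disjoint
union of its maximal cubes `Q`, and `‖T̄(fσ)‖_{L^p(w)}^p` is comparable to the sum over `k` and `Q`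
of `2^{kp} w(E)`, with `E` the part of `Q` where `2^{k+1} < T̄(fσ) ≤ 2^{k+2}`. On `E` the cubes
inside `Q` contribute at least `2^k`; pair this contribution with its extremal `ℓ^{q'}` sequence.
Only the averages of `f` over the cubes meeting `E` enter, and they do not change when `f` is
replaced by its averages over the maximal cubes of `{T̄(fσ) > 2^{k+2}}`. Those averages that are at
most twice an average of `f` already seen above `Q` act as a constant on `Q`, and the direct
testing condition, applied at the principal cubes of `f`, sums them by the maximal theorem. The
rest of `f` is paired using the dual testing condition; it sums over `k` because along each point
the new averages at least double, so that they form a geometric series dominated by the maximal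
function. The exponents `1/r ≥ 1/p` enter through `ℓ^1 ⊆ ℓ^{p/r}`.
-/

namespace VectorDyadic

section ENNReal

lemma two_zpow_add_one (k : ℤ) : (2 : ℝ≥0∞) ^ (k + 1) = 2 * 2 ^ k := by
  rw [ENNReal.zpow_add (by simp) (by simp), zpow_one, mul_comm]

lemma monotone_two_zpow : Monotone fun k : ℤ => (2 : ℝ≥0∞) ^ k :=
  ENNReal.monotone_zpow one_le_two

lemma rpow_sub_one_mul_self {s : ℝ} (hs : 1 ≤ s) (x : ℝ≥0∞) : x ^ (s - 1) * x = x ^ s := by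
  simpa using (ENNReal.rpow_add_of_nonneg (x := x) (s - 1) 1 (by linarith) zero_le_one).symm

lemma rpow_one_div_rpow {s : ℝ} (hs : s ≠ 0) (x : ℝ≥0∞) : (x ^ (1 / s)) ^ s = x := by
  rw [← ENNReal.rpow_mul, one_div_mul_cancel hs, ENNReal.rpow_one]

lemma two_mul_rpow_le {s : ℝ} (hs : 1 ≤ s) (x : ℝ≥0∞) : 2 * x ^ s ≤ (2 * x) ^ s := by
  simpa only [two_mul] using ENNReal.add_rpow_le_rpow_add x x hs

lemma tsum_rpow_le_rpow_tsum {ι : Type*} (x : ι → ℝ≥0∞) {s : ℝ} (hs : 1 ≤ s) :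
    ∑' i, x i ^ s ≤ (∑' i, x i) ^ s := by
  simp_rw [← rpow_sub_one_mul_self hs]
  rw [← ENNReal.tsum_mul_left]
  exact ENNReal.tsum_le_tsum fun i =>
    mul_le_mul_left (ENNReal.rpow_le_rpow (ENNReal.le_tsum i) (sub_nonneg.2 hs)) _

lemma sum_rpow_le_rpow_sum {ι : Type*} (F : Finset ι) (x : ι → ℝ≥0∞) {s : ℝ} (hs : 1 ≤ s) :
    ∑ i ∈ F, x i ^ s ≤ (∑ i ∈ F, x i) ^ s := by
  rw [← Finset.tsum_subtype, ← Finset.tsum_subtype]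
  exact tsum_rpow_le_rpow_tsum _ hs

lemma le_rpow_of_le_mul_rpow {s s' : ℝ} (hs : s.HolderConjugate s') {N b : ℝ≥0∞} (hN : N ≠ ∞)
    (h : N ≤ b * N ^ (1 / s')) : N ≤ b ^ s := by
  rcases eq_or_ne N 0 with rfl | h0
  · exact zero_le
  have hpos : N ^ (1 / s') ≠ 0 := (ENNReal.rpow_pos (pos_iff_ne_zero.2 h0) hN).ne'
  have hfin : N ^ (1 / s') ≠ ∞ := ENNReal.rpow_ne_top_of_nonneg hs.symm.one_div_nonneg hN
  have hroot : N ^ (1 / s) ≤ b := by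
    rwa [← ENNReal.mul_le_mul_iff_left hpos hfin, ← ENNReal.rpow_add _ _ h0 hN,
      hs.one_div_add_one_div, one_div_one, ENNReal.rpow_one]
  simpa only [rpow_one_div_rpow hs.ne_zero] using ENNReal.rpow_le_rpow hroot hs.nonneg

lemma le_two_mul_of_le_half_add {x y : ℝ≥0∞} (hx : x ≠ ∞) (h : x ≤ x / 2 + y) : x ≤ 2 * y := by
  have hhalf : x / 2 ≤ y := by
    rwa [← ENNReal.add_le_add_iff_left (ENNReal.div_ne_top hx two_ne_zero), ENNReal.add_halves]
  calc x = 2 * (x / 2) := (ENNReal.mul_div_cancel two_ne_zero ENNReal.ofNat_ne_top).symm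
    _ ≤ 2 * y := by gcongr

/-- The sum of the geometric series of ratio `2 ^ (-s)`. -/
noncomputable def geomConst (s : ℝ) : ℝ≥0∞ := (1 - (2 : ℝ≥0∞) ^ (-s))⁻¹

lemma geomConst_ne_zero (s : ℝ) : geomConst s ≠ 0 := by
  simp [geomConst]

lemma geomConst_ne_top {s : ℝ} (hs : 0 < s) : geomConst s ≠ ∞ := by
  have h : (2 : ℝ≥0∞) ^ (-s) < 1 :=
    ENNReal.rpow_lt_one_of_one_lt_of_neg ENNReal.one_lt_two (by linarith)
  rwa [geomConst, Ne, ENNReal.inv_eq_top, tsub_eq_zero_iff_le, not_le]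

lemma tsum_two_zpow_sub_rpow {s : ℝ} (hs : 0 ≤ s) (n : ℤ) :
    ∑' i : ℕ, ((2 : ℝ≥0∞) ^ (n - i)) ^ s = geomConst s * ((2 : ℝ≥0∞) ^ n) ^ s := by
  rw [geomConst, ← ENNReal.tsum_geometric, ← ENNReal.tsum_mul_right]
  refine tsum_congr fun i => ?_
  rw [sub_eq_add_neg, add_comm, ENNReal.zpow_add (by simp) (by simp),
    ENNReal.mul_rpow_of_nonneg _ _ hs, ← ENNReal.rpow_natCast, ← ENNReal.rpow_mul,
    ← ENNReal.rpow_intCast, ← ENNReal.rpow_mul]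
  push_cast
  ring_nf

lemma tsum_two_zpow_lt_le {s : ℝ} (hs : 0 < s) (t : ℝ≥0∞) :
    ∑' k : ℤ, (if (2 : ℝ≥0∞) ^ k < t then ((2 : ℝ≥0∞) ^ k) ^ s else 0) ≤ geomConst s * t ^ s := by
  rcases eq_or_ne t 0 with rfl | h0
  · simp
  rcases eq_or_ne t ∞ with rfl | ht
  · simp [ENNReal.top_rpow_of_pos hs, ENNReal.mul_top (geomConst_ne_zero s)]
  obtain ⟨n, hn, hn'⟩ := ENNReal.exists_mem_Ioc_zpow h0 ht ENNReal.one_lt_two (by simp)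
  have hinj : Function.Injective fun i : ℕ => n - (i : ℤ) := fun i j h => by simpa using h
  have hsupp : Function.support
      (fun k : ℤ => if (2 : ℝ≥0∞) ^ k < t then ((2 : ℝ≥0∞) ^ k) ^ s else 0) ⊆
        range fun i : ℕ => n - (i : ℤ) := by
    intro k hk
    have hlt : (2 : ℝ≥0∞) ^ k < 2 ^ (n + 1) := (of_not_not fun h => hk (if_neg h)).trans_le hn'
    have := monotone_two_zpow.reflect_lt hlt
    exact ⟨(n - k).toNat, by simp only; omega⟩
  calc ∑' k : ℤ, (if (2 : ℝ≥0∞) ^ k < t then ((2 : ℝ≥0∞) ^ k) ^ s else 0)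
      = ∑' i : ℕ, (if (2 : ℝ≥0∞) ^ (n - i : ℤ) < t then ((2 : ℝ≥0∞) ^ (n - i : ℤ)) ^ s else 0) :=
        (hinj.tsum_eq hsupp).symm
    _ ≤ ∑' i : ℕ, ((2 : ℝ≥0∞) ^ (n - i : ℤ)) ^ s := by
        gcongr
        split_ifs
        exacts [le_rfl, zero_le]
    _ = geomConst s * ((2 : ℝ≥0∞) ^ n) ^ s := tsum_two_zpow_sub_rpow hs.le n
    _ ≤ geomConst s * t ^ s := by gcongr

lemma sum_Ico_tsub_add {β : ℤ → ℝ≥0∞} (hβ : Monotone β) {a b : ℤ} (hab : a ≤ b) :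
    ∑ k ∈ Finset.Ico a b, (β (k + 1) - β k) + β a = β b := by
  induction b, hab using Int.leInduction with
  | base => simp
  | succ b hab ih =>
    rw [← Finset.insert_Ico_right_eq_Ico_add_one hab, Finset.sum_insert Finset.right_notMem_Ico,
      add_assoc, ih, tsub_add_cancel_of_le (hβ (by lia))]

lemma tsum_tsub_succ_le {β : ℤ → ℝ≥0∞} (hβ : Monotone β) {M : ℝ≥0∞} (hM : ∀ k, β k ≤ M) :
    ∑' k, (β (k + 1) - β k) ≤ M := by
  rw [ENNReal.tsum_eq_iSup_sum]
  refine iSup_le fun s => ?_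
  obtain ⟨a, ha⟩ := s.bddBelow
  obtain ⟨b, hb⟩ := s.bddAbove
  have hsub : s ⊆ Finset.Ico a (max a (b + 1)) := fun k hk => by
    have := ha hk
    have := hb hk
    simp only [Finset.mem_Ico]
    lia
  calc ∑ k ∈ s, (β (k + 1) - β k)
      ≤ ∑ k ∈ Finset.Ico a (max a (b + 1)), (β (k + 1) - β k) + β a :=
        (Finset.sum_le_sum_of_subset hsub).trans le_self_add
    _ = β (max a (b + 1)) := sum_Ico_tsub_add hβ (le_max_left _ _)
    _ ≤ M := hM _

lemma tsum_tsub_add_two_le {β : ℤ → ℝ≥0∞} (hβ : Monotone β) {M : ℝ≥0∞} (hM : ∀ k, β k ≤ M) :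
    ∑' k, (β (k + 2) - β k) ≤ 2 * M := by
  calc ∑' k, (β (k + 2) - β k)
      ≤ ∑' k, ((β (k + 1 + 1) - β (k + 1)) + (β (k + 1) - β k)) := by
        simp_rw [add_assoc, one_add_one_eq_two]
        exact ENNReal.tsum_le_tsum fun k => tsub_le_tsub_add_tsub
    _ = ∑' k, (β (k + 1 + 1) - β (k + 1)) + ∑' k, (β (k + 1) - β k) := ENNReal.tsum_add
    _ ≤ M + M := add_le_add
        (tsum_tsub_succ_le (β := fun k => β (k + 1)) (fun _ _ h => hβ (by lia)) fun _ => hM _)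
        (tsum_tsub_succ_le hβ hM)
    _ = 2 * M := (two_mul M).symm

lemma tsum_doubling_rpow_le {β : ℤ → ℝ≥0∞} (hβ : Monotone β) {M : ℝ≥0∞} (hMt : M ≠ ∞)
    (hM : ∀ k, β k ≤ M) {s : ℝ} (hs : 1 ≤ s) :
    ∑' k, (if 2 * β k < β (k + 2) then β (k + 2) else 0) ^ s ≤ 4 * M ^ s := by
  have hs0 : 0 ≤ s := by linarith
  calc ∑' k, (if 2 * β k < β (k + 2) then β (k + 2) else 0) ^ s
      ≤ ∑' k, 2 * (β (k + 2) ^ s - β k ^ s) := by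
        refine ENNReal.tsum_le_tsum fun k => ?_
        split_ifs with h
        · have hdouble : 2 * β k ^ s ≤ β (k + 2) ^ s :=
            (two_mul_rpow_le hs _).trans (by gcongr)
          have hfin : β k ^ s ≠ ∞ :=
            ENNReal.rpow_ne_top_of_nonneg hs0 (ne_top_of_le_ne_top hMt (hM k))
          rw [ENNReal.mul_sub fun _ _ => ENNReal.ofNat_ne_top]
          refine ENNReal.le_sub_of_add_le_left (by finiteness) ?_
          rw [two_mul (β (k + 2) ^ s)]
          gcongr
        · simp [ENNReal.zero_rpow_of_pos (zero_lt_one.trans_le hs)]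
    _ = 2 * ∑' k, (β (k + 2) ^ s - β k ^ s) := ENNReal.tsum_mul_left
    _ ≤ 2 * (2 * M ^ s) := by
        gcongr
        exact tsum_tsub_add_two_le (β := fun k => β k ^ s)
          (fun i j h => ENNReal.rpow_le_rpow (hβ h) hs0) fun k => ENNReal.rpow_le_rpow (hM k) hs0
    _ = 4 * M ^ s := by rw [← mul_assoc]; norm_num

-- If `e ≤ ε W` the first term on the right suffices; otherwise `W ≤ e / ε`, and the `p`-th power
-- of the hypothesis `t e ≤ X + Y` can be divided by `e ^ (p - 1)`.
lemma rpow_mul_le_of_mul_le_add {p : ℝ} (hp : 1 ≤ p) {t e W X Y x y ε : ℝ≥0∞} (he : e ≠ ∞)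
    (hε : ε ≠ 0) (hε' : ε ≠ ∞) (h : t * e ≤ X + Y) (hX : X ^ p ≤ x * W ^ (p - 1))
    (hY : Y ^ p ≤ y * e ^ (p - 1)) :
    t ^ p * e ≤ ε * (t ^ p * W) + 2 ^ (p - 1) * (ε⁻¹ ^ (p - 1) * x + y) := by
  have hp0 : 0 ≤ p := by linarith
  have hp1 : 0 ≤ p - 1 := by linarith
  rcases le_or_gt e (ε * W) with hle | hlt
  · calc t ^ p * e ≤ t ^ p * (ε * W) := by gcongr
      _ = ε * (t ^ p * W) := by ring
      _ ≤ _ := le_self_add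
  have hW : W ≤ ε⁻¹ * e := by
    rw [mul_comm, ← div_eq_mul_inv, ENNReal.le_div_iff_mul_le (Or.inl hε) (Or.inl hε'), mul_comm]
    exact hlt.le
  have hpos : e ^ (p - 1) ≠ 0 := (ENNReal.rpow_pos (bot_lt_of_lt hlt) he).ne'
  refine le_trans ?_ le_add_self
  rw [← ENNReal.mul_le_mul_iff_left hpos (ENNReal.rpow_ne_top_of_nonneg hp1 he)]
  calc t ^ p * e * e ^ (p - 1) = (t * e) ^ p := by
        rw [ENNReal.mul_rpow_of_nonneg _ _ hp0, mul_assoc, mul_comm e, rpow_sub_one_mul_self hp]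
    _ ≤ (X + Y) ^ p := by gcongr
    _ ≤ 2 ^ (p - 1) * (X ^ p + Y ^ p) := ENNReal.rpow_add_le_mul_rpow_add_rpow _ _ hp
    _ ≤ 2 ^ (p - 1) * (x * (ε⁻¹ * e) ^ (p - 1) + y * e ^ (p - 1)) := by
        gcongr
        exact hX.trans (by gcongr)
    _ = _ := by
        rw [ENNReal.mul_rpow_of_nonneg _ _ hp1]
        ring

end ENNReal

section LevelSets

variable {X : Type*} {f g : X → ℝ≥0∞} {k : ℤ} {x : X}

/-- The dyadic layer `{2 ^ k < g ≤ 2 ^ (k + 1)}` of `g`. -/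
def layer (g : X → ℝ≥0∞) (k : ℤ) : Set X :=
  g ⁻¹' Ioc (2 ^ k) (2 ^ (k + 1))

lemma pairwise_disjoint_layer (g : X → ℝ≥0∞) : Pairwise (Function.onFun Disjoint (layer g)) :=
  fun _ _ h => (monotone_two_zpow.pairwise_disjoint_on_Ioc_succ h).preimage g

lemma exists_mem_layer (h0 : g x ≠ 0) (h : g x ≠ ∞) : ∃ k, x ∈ layer g k :=
  ENNReal.exists_mem_Ioc_zpow h0 h ENNReal.one_lt_two (by simp)

variable [MeasurableSpace X]

/-- The dyadic sum comparable to `∫ g ^ r` which is built from the level sets of `g`. -/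
noncomputable def levelSum (r : ℝ) (μ : Measure X) (g : X → ℝ≥0∞) : ℝ≥0∞ :=
  ∑' k : ℤ, ((2 : ℝ≥0∞) ^ k) ^ r * μ {x | 2 ^ k < g x}

variable {μ : Measure X}

lemma measurableSet_layer (hg : Measurable g) (k : ℤ) : MeasurableSet (layer g k) :=
  hg measurableSet_Ioc

lemma tsum_setLIntegral_layer_le (hg : Measurable g) (f : X → ℝ≥0∞) :
    ∑' k, ∫⁻ x in layer g k, f x ∂μ ≤ ∫⁻ x, f x ∂μ := by
  rw [← lintegral_iUnion (measurableSet_layer hg) (pairwise_disjoint_layer g)]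
  exact setLIntegral_le_lintegral _ _

lemma tsum_setLIntegral_Ioc_le (hg : Measurable g) (f : X → ℝ≥0∞) :
    ∑' k : ℤ, ∫⁻ x in g ⁻¹' Ioc (2 ^ k) (2 ^ (k + 2)), f x ∂μ ≤ 2 * ∫⁻ x, f x ∂μ := by
  calc ∑' k : ℤ, ∫⁻ x in g ⁻¹' Ioc (2 ^ k) (2 ^ (k + 2)), f x ∂μ
      ≤ ∑' k : ℤ, (∫⁻ x in layer g k, f x ∂μ + ∫⁻ x in layer g (k + 1), f x ∂μ) := by
        refine ENNReal.tsum_le_tsum fun k => ?_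
        have hunion : g ⁻¹' Ioc (2 ^ k) (2 ^ (k + 2)) = layer g k ∪ layer g (k + 1) := by
          rw [layer, layer, ← preimage_union, Ioc_union_Ioc_eq_Ioc (monotone_two_zpow (by lia))
            (monotone_two_zpow (by lia)), add_assoc, one_add_one_eq_two]
        rw [hunion]
        exact lintegral_union_le _ _ _
    _ = ∑' k : ℤ, ∫⁻ x in layer g k, f x ∂μ + ∑' k : ℤ, ∫⁻ x in layer g k, f x ∂μ := by
        rw [ENNReal.tsum_add]
        exact congrArg _ ((Equiv.addRight (1 : ℤ)).tsum_eq fun k => ∫⁻ x in layer g k, f x ∂μ)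
    _ ≤ 2 * ∫⁻ x, f x ∂μ := by
        rw [two_mul]
        gcongr <;> exact tsum_setLIntegral_layer_le hg f

lemma lintegral_rpow_le_tsum_layer (hg : Measurable g) (hg' : ∀ x, g x ≠ ∞) {s : ℝ} (hs : 0 < s) :
    ∫⁻ x, g x ^ s ∂μ ≤ ∑' k : ℤ, ((2 : ℝ≥0∞) ^ (k + 1)) ^ s * μ (layer g k) := by
  have hsupp : Function.support (fun x => g x ^ s) ⊆ ⋃ k, layer g k := fun x hx =>
    mem_iUnion.2 (exists_mem_layer (fun h => hx (by simp [h, hs])) (hg' x))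
  rw [← setLIntegral_eq_of_support_subset hsupp,
    lintegral_iUnion (measurableSet_layer hg) (pairwise_disjoint_layer g)]
  refine ENNReal.tsum_le_tsum fun k => ?_
  rw [← setLIntegral_const]
  exact setLIntegral_mono measurable_const fun x hx => ENNReal.rpow_le_rpow hx.2 hs.le

lemma lintegral_rpow_le_levelSum (hg : Measurable g) (hg' : ∀ x, g x ≠ ∞) {s : ℝ} (hs : 0 < s) :
    ∫⁻ x, g x ^ s ∂μ ≤ 2 ^ s * levelSum s μ g := by
  refine (lintegral_rpow_le_tsum_layer hg hg' hs).trans ?_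
  rw [levelSum, ← ENNReal.tsum_mul_left]
  refine ENNReal.tsum_le_tsum fun k => ?_
  rw [two_zpow_add_one, ENNReal.mul_rpow_of_nonneg _ _ hs.le, mul_assoc]
  gcongr
  exact fun x hx => hx.1

lemma tsum_two_zpow_rpow_mul_setLIntegral_le (hf : Measurable f) (hg : Measurable g) {s : ℝ}
    (hs : 0 < s) :
    ∑' k : ℤ, ((2 : ℝ≥0∞) ^ k) ^ s * ∫⁻ x in {x | 2 ^ k < g x}, f x ∂μ ≤
      geomConst s * ∫⁻ x, f x * g x ^ s ∂μ := by
  have hS : ∀ k : ℤ, MeasurableSet {x | (2 : ℝ≥0∞) ^ k < g x} := fun k =>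
    measurableSet_lt measurable_const hg
  calc ∑' k : ℤ, ((2 : ℝ≥0∞) ^ k) ^ s * ∫⁻ x in {x | 2 ^ k < g x}, f x ∂μ
      = ∑' k : ℤ, ∫⁻ x, f x * (if (2 : ℝ≥0∞) ^ k < g x then ((2 : ℝ≥0∞) ^ k) ^ s else 0) ∂μ := by
        refine tsum_congr fun k => ?_
        rw [← lintegral_indicator (hS k), ← lintegral_const_mul _ (hf.indicator (hS k))]
        refine lintegral_congr fun x => ?_
        by_cases hx : (2 : ℝ≥0∞) ^ k < g x <;> simp [hx, mul_comm]
    _ = ∫⁻ x, ∑' k : ℤ,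
          f x * (if (2 : ℝ≥0∞) ^ k < g x then ((2 : ℝ≥0∞) ^ k) ^ s else 0) ∂μ :=
        (lintegral_tsum fun k => (hf.mul
          (Measurable.ite (hS k) measurable_const measurable_const)).aemeasurable).symm
    _ ≤ ∫⁻ x, geomConst s * (f x * g x ^ s) ∂μ := by
        refine lintegral_mono fun x => ?_
        dsimp only
        rw [ENNReal.tsum_mul_left, mul_left_comm]
        gcongr
        exact tsum_two_zpow_lt_le hs _
    _ = geomConst s * ∫⁻ x, f x * g x ^ s ∂μ := lintegral_const_mul _ (hf.mul (hg.pow_const s))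

lemma levelSum_le_lintegral_rpow (hg : Measurable g) {s : ℝ} (hs : 0 < s) :
    levelSum s μ g ≤ geomConst s * ∫⁻ x, g x ^ s ∂μ := by
  simpa [levelSum] using
    tsum_two_zpow_rpow_mul_setLIntegral_le (μ := μ) (measurable_const (a := 1)) hg hs

lemma levelSum_le_of_mul_measure_le (hf : Measurable f) (hg : Measurable g)
    (h : ∀ t, t * μ {x | t < g x} ≤ ∫⁻ x in {x | t < g x}, f x ∂μ) {r : ℝ} (hr : 1 < r) :
    levelSum r μ g ≤ geomConst (r - 1) * ∫⁻ x, f x * g x ^ (r - 1) ∂μ := by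
  refine le_trans (ENNReal.tsum_le_tsum fun k => ?_)
    (tsum_two_zpow_rpow_mul_setLIntegral_le hf hg (sub_pos.2 hr))
  rw [← rpow_sub_one_mul_self hr.le, mul_assoc]
  gcongr
  exact h _

/-- The constant in the maximal theorem. -/
noncomputable def maximalConst (r : ℝ) : ℝ≥0∞ := (2 ^ r * geomConst (r - 1)) ^ r

lemma maximalConst_ne_top {r : ℝ} (hr : 1 < r) : maximalConst r ≠ ∞ :=
  ENNReal.rpow_ne_top_of_nonneg (by linarith) (ENNReal.mul_ne_top
    (ENNReal.rpow_ne_top_of_nonneg (by linarith) ENNReal.ofNat_ne_top)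
    (geomConst_ne_top (sub_pos.2 hr)))

lemma lintegral_rpow_le_of_mul_measure_le (hf : Measurable f) (hg : Measurable g)
    (hg' : ∀ x, g x ≠ ∞) {r : ℝ} (hr : 1 < r) (hgr : ∫⁻ x, g x ^ r ∂μ ≠ ∞)
    (h : ∀ t, t * μ {x | t < g x} ≤ ∫⁻ x in {x | t < g x}, f x ∂μ) :
    ∫⁻ x, g x ^ r ∂μ ≤ maximalConst r * ∫⁻ x, f x ^ r ∂μ := by
  have hr0 : 0 < r := by linarith
  have hc := Real.HolderConjugate.conjExponent hr
  have hself : ∫⁻ x, g x ^ r ∂μ ≤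
      2 ^ r * geomConst (r - 1) * (∫⁻ x, f x ^ r ∂μ) ^ (1 / r) *
        (∫⁻ x, g x ^ r ∂μ) ^ (1 / r.conjExponent) := by
    calc ∫⁻ x, g x ^ r ∂μ ≤ 2 ^ r * levelSum r μ g := lintegral_rpow_le_levelSum hg hg' hr0
      _ ≤ 2 ^ r * (geomConst (r - 1) * ∫⁻ x, f x * g x ^ (r - 1) ∂μ) := by
          gcongr
          exact levelSum_le_of_mul_measure_le hf hg h hr
      _ ≤ 2 ^ r * (geomConst (r - 1) * ((∫⁻ x, f x ^ r ∂μ) ^ (1 / r) *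
            (∫⁻ x, (g x ^ (r - 1)) ^ r.conjExponent ∂μ) ^ (1 / r.conjExponent))) := by
          gcongr
          exact ENNReal.lintegral_mul_le_Lp_mul_Lq μ hc hf.aemeasurable
            (hg.pow_const (r - 1)).aemeasurable
      _ = _ := by
          simp_rw [← ENNReal.rpow_mul, hc.sub_one_mul_conj]
          ring
  refine (le_rpow_of_le_mul_rpow hc hgr hself).trans_eq ?_
  rw [ENNReal.mul_rpow_of_nonneg _ _ hr0.le, rpow_one_div_rpow hr0.ne', maximalConst]

end LevelSets

section MaximalFunction

variable {X : Type*} {F : Finset (Set X)} {φ : Set X → ℝ≥0∞} {t M : ℝ≥0∞} {x : X} {Q R : Set X}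

/-- The maximal function `x ↦ sup {φ R : x ∈ R ∈ F}`. -/
noncomputable def maximalFunction (F : Finset (Set X)) (φ : Set X → ℝ≥0∞) (x : X) : ℝ≥0∞ :=
  F.sup fun R => R.indicator (fun _ => φ R) x

open Classical in
/-- The members `Q` of `F` with `t < φ Q` which are maximal, in the sense that `φ ≤ t` on all
members of `F` strictly containing `Q`. -/
noncomputable def maximalSets (F : Finset (Set X)) (φ : Set X → ℝ≥0∞) (t : ℝ≥0∞) :
    Finset (Set X) :=
  F.filter fun Q => t < φ Q ∧ ∀ R ∈ F, Q ⊂ R → φ R ≤ t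

open Classical in
/-- The supremum of `φ` over the members of `F` containing `Q`. -/
noncomputable def ancestorSup (F : Finset (Set X)) (φ : Set X → ℝ≥0∞) (Q : Set X) : ℝ≥0∞ :=
  (F.filter (Q ⊆ ·)).sup φ

lemma le_maximalFunction (hR : R ∈ F) (hx : x ∈ R) : φ R ≤ maximalFunction F φ x := by
  simpa [hx, maximalFunction] using Finset.le_sup (f := fun R => R.indicator (fun _ => φ R) x) hR

lemma maximalFunction_le (h : ∀ R ∈ F, x ∈ R → φ R ≤ M) : maximalFunction F φ x ≤ M :=
  Finset.sup_le fun R hR => by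
    by_cases hx : x ∈ R
    · simpa [hx] using h R hR hx
    · simp [hx]

lemma maximalFunction_ne_top (hφ : ∀ R ∈ F, φ R ≠ ∞) : maximalFunction F φ x ≠ ∞ := by
  refine ((Finset.sup_lt_iff (by simp)).2 fun R hR => ?_).ne
  exact (indicator_le_self _ (fun _ => φ R) x).trans_lt (hφ R hR).lt_top

lemma maximalFunction_rpow_le_sum {r : ℝ} (hr : 0 < r) :
    maximalFunction F φ x ^ r ≤ ∑ R ∈ F, R.indicator (fun _ => φ R ^ r) x := by
  rw [← ENNReal.le_rpow_inv_iff hr]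
  refine maximalFunction_le fun R hR hx => ?_
  rw [ENNReal.le_rpow_inv_iff hr]
  simpa [hx] using
    Finset.single_le_sum (f := fun R : Set X => R.indicator (fun _ => φ R ^ r) x)
      (fun _ _ => zero_le) hR

lemma le_ancestorSup (hR : R ∈ F) (h : Q ⊆ R) : φ R ≤ ancestorSup F φ Q := by
  classical exact Finset.le_sup (f := φ) (Finset.mem_filter.2 ⟨hR, h⟩)

lemma lt_ancestorSup_iff : t < ancestorSup F φ Q ↔ ∃ R ∈ F, Q ⊆ R ∧ t < φ R := by
  classical
  simp [ancestorSup, Finset.lt_sup_iff, and_assoc]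

lemma ancestorSup_ne_top (hφ : ∀ R ∈ F, φ R ≠ ∞) : ancestorSup F φ Q ≠ ∞ := by
  classical
  exact ((Finset.sup_lt_iff (by simp)).2 fun R hR =>
    (hφ R (Finset.mem_of_mem_filter R hR)).lt_top).ne

lemma mem_maximalSets :
    Q ∈ maximalSets F φ t ↔ Q ∈ F ∧ t < φ Q ∧ ∀ R ∈ F, Q ⊂ R → φ R ≤ t := by
  simp [maximalSets]

lemma maximalSets_subset (F : Finset (Set X)) (φ : Set X → ℝ≥0∞) (t : ℝ≥0∞) :
    maximalSets F φ t ⊆ F := by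
  classical exact Finset.filter_subset _ _

lemma exists_maximalSets_superset (hR : R ∈ F) (h : t < φ R) : ∃ Q ∈ maximalSets F φ t, R ⊆ Q := by
  classical
  obtain ⟨Q, hRQ, hQ⟩ := (F.filter (t < φ ·)).exists_le_maximal (Finset.mem_filter.2 ⟨hR, h⟩)
  have hQF := Finset.mem_filter.1 hQ.prop
  refine ⟨Q, mem_maximalSets.2 ⟨hQF.1, hQF.2, fun S hS hQS => ?_⟩, hRQ⟩
  by_contra hlt
  exact hQS.2 (hQ.le_of_ge (Finset.mem_filter.2 ⟨hS, not_le.1 hlt⟩) hQS.1)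

lemma lt_maximalFunction_iff : t < maximalFunction F φ x ↔ ∃ Q ∈ maximalSets F φ t, x ∈ Q := by
  constructor
  · intro h
    by_contra! hne
    refine h.not_ge (maximalFunction_le fun R hR hx => ?_)
    by_contra! hlt
    obtain ⟨Q, hQ, hRQ⟩ := exists_maximalSets_superset hR hlt
    exact hne Q hQ (hRQ hx)
  · rintro ⟨Q, hQ, hx⟩
    have hQ' := mem_maximalSets.1 hQ
    exact hQ'.2.1.trans_le (le_maximalFunction hQ'.1 hx)

lemma setOf_lt_maximalFunction : {x | t < maximalFunction F φ x} = ⋃ Q ∈ maximalSets F φ t, Q := by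
  ext x
  simp [lt_maximalFunction_iff]

variable [MeasurableSpace X]

/-- A family of measurable sets any two of which are nested or disjoint. The notion covers both
dyadic grids and their finite subfamilies. -/
structure IsNestedFamily (𝒟 : Set (Set X)) : Prop where
  measurableSet : ∀ Q ∈ 𝒟, MeasurableSet Q
  nested : ∀ Q ∈ 𝒟, ∀ R ∈ 𝒟, Q ⊆ R ∨ R ⊆ Q ∨ Disjoint Q R

lemma IsNestedFamily.mono {𝒟 ℰ : Set (Set X)} (h : IsNestedFamily 𝒟) (hs : ℰ ⊆ 𝒟) :
    IsNestedFamily ℰ where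
  measurableSet Q hQ := h.measurableSet Q (hs hQ)
  nested Q hQ R hR := h.nested Q (hs hQ) R (hs hR)

namespace IsNestedFamily

lemma subset_or_ssubset {𝒟 : Set (Set X)} (h : IsNestedFamily 𝒟) (hQ : Q ∈ 𝒟) (hR : R ∈ 𝒟)
    (hxQ : x ∈ Q) (hxR : x ∈ R) : Q ⊆ R ∨ R ⊂ Q := by
  rcases h.nested Q hQ R hR with hQR | hRQ | hd
  · exact Or.inl hQR
  · exact (eq_or_ssubset_of_subset hRQ).imp (fun h => h.ge) id
  · exact absurd hxR (disjoint_left.1 hd hxQ)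

variable (hF : IsNestedFamily (F : Set (Set X)))
include hF

lemma pairwiseDisjoint_maximalSets (φ : Set X → ℝ≥0∞) (t : ℝ≥0∞) :
    (maximalSets F φ t : Set (Set X)).PairwiseDisjoint fun Q => Q := by
  intro Q hQ R hR hne
  have hQ := mem_maximalSets.1 hQ
  have hR := mem_maximalSets.1 hR
  rcases hF.nested Q hQ.1 R hR.1 with h | h | h
  · exact absurd (hQ.2.2 R hR.1 (h.ssubset_of_ne hne)) hR.2.1.not_ge
  · exact absurd (hR.2.2 Q hQ.1 (h.ssubset_of_ne hne.symm)) hQ.2.1.not_ge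
  · exact h

lemma measurableSet_of_mem_maximalSets (hQ : Q ∈ maximalSets F φ t) : MeasurableSet Q :=
  hF.measurableSet Q (maximalSets_subset F φ t hQ)

lemma measurable_maximalFunction (φ : Set X → ℝ≥0∞) : Measurable (maximalFunction F φ) := by
  refine measurable_of_Ioi fun t => ?_
  rw [show maximalFunction F φ ⁻¹' Ioi t = _ from setOf_lt_maximalFunction]
  exact Finset.measurableSet_biUnion _ fun Q => hF.measurableSet_of_mem_maximalSets

lemma measurableSet_lt_maximalFunction (φ : Set X → ℝ≥0∞) (t : ℝ≥0∞) :
    MeasurableSet {x | t < maximalFunction F φ x} :=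
  measurableSet_lt measurable_const (hF.measurable_maximalFunction φ)

lemma sum_measure_maximalSets (φ : Set X → ℝ≥0∞) (t : ℝ≥0∞) (μ : Measure X) :
    ∑ Q ∈ maximalSets F φ t, μ Q = μ {x | t < maximalFunction F φ x} := by
  rw [setOf_lt_maximalFunction, measure_biUnion_finset (hF.pairwiseDisjoint_maximalSets φ t)
    fun Q => hF.measurableSet_of_mem_maximalSets]

lemma sum_setLIntegral_maximalSets (φ : Set X → ℝ≥0∞) (t : ℝ≥0∞) (μ : Measure X)
    (f : X → ℝ≥0∞) :
    ∑ Q ∈ maximalSets F φ t, ∫⁻ x in Q, f x ∂μ =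
      ∫⁻ x in {x | t < maximalFunction F φ x}, f x ∂μ := by
  rw [setOf_lt_maximalFunction, lintegral_biUnion_finset (hF.pairwiseDisjoint_maximalSets φ t)
    fun Q => hF.measurableSet_of_mem_maximalSets]

end IsNestedFamily

variable {μ : Measure X} {f : X → ℝ≥0∞}

lemma rpow_setLIntegral_le {p : ℝ} (hp : 1 ≤ p) (hf : AEMeasurable f μ) (E : Set X) :
    (∫⁻ x in E, f x ∂μ) ^ p ≤ (∫⁻ x in E, f x ^ p ∂μ) * μ E ^ (p - 1) := by
  rcases hp.eq_or_lt with rfl | hp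
  · simp
  have hc := Real.HolderConjugate.conjExponent hp
  have hle : ∫⁻ x in E, f x ∂μ ≤
      (∫⁻ x in E, f x ^ p ∂μ) ^ (1 / p) * μ E ^ (1 / p.conjExponent) := by
    simpa using ENNReal.lintegral_mul_le_Lp_mul_Lq (μ.restrict E) hc hf.restrict
      (aemeasurable_const (b := (1 : ℝ≥0∞)))
  refine (ENNReal.rpow_le_rpow hle hc.nonneg).trans_eq ?_
  rw [ENNReal.mul_rpow_of_nonneg _ _ hc.nonneg, rpow_one_div_rpow hc.ne_zero, ← ENNReal.rpow_mul,
    one_div_mul_eq_div, hc.div_conj_eq_sub_one]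

lemma setLIntegral_ne_top_of_rpow (hμ : μ Q ≠ ∞) (hf : AEMeasurable f μ) {r : ℝ} (hr : 1 < r)
    (hfr : ∫⁻ x, f x ^ r ∂μ ≠ ∞) : ∫⁻ x in Q, f x ∂μ ≠ ∞ := by
  intro htop
  have hle := rpow_setLIntegral_le hr.le hf Q
  rw [htop, ENNReal.top_rpow_of_pos (by linarith), top_le_iff] at hle
  exact ENNReal.mul_ne_top (ne_top_of_le_ne_top hfr (setLIntegral_le_lintegral _ _))
    (ENNReal.rpow_ne_top_of_nonneg (by linarith) hμ) hle

/-- The average of `f` over `Q` with respect to `μ`. -/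
noncomputable def mean (μ : Measure X) (f : X → ℝ≥0∞) (Q : Set X) : ℝ≥0∞ := ⨍⁻ x in Q, f x ∂μ

lemma mean_mul_measure (hμ : μ Q ≠ ∞) : mean μ f Q * μ Q = ∫⁻ x in Q, f x ∂μ := by
  rw [mul_comm, mean, measure_mul_setLAverage f hμ]

lemma mean_ne_top (hμ : μ Q ≠ ∞) (hf : AEMeasurable f μ) {r : ℝ} (hr : 1 < r)
    (hfr : ∫⁻ x, f x ^ r ∂μ ≠ ∞) : mean μ f Q ≠ ∞ :=
  (setLAverage_lt_top (setLIntegral_ne_top_of_rpow hμ hf hr hfr)).ne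

namespace IsNestedFamily

variable (hF : IsNestedFamily (F : Set (Set X))) (hμ : ∀ Q ∈ F, μ Q ≠ ∞)
include hF hμ

lemma mul_measure_lt_maximalFunction_le (f : X → ℝ≥0∞) (t : ℝ≥0∞) :
    t * μ {x | t < maximalFunction F (mean μ f) x} ≤
      ∫⁻ x in {x | t < maximalFunction F (mean μ f) x}, f x ∂μ := by
  rw [← hF.sum_measure_maximalSets, ← hF.sum_setLIntegral_maximalSets, Finset.mul_sum]
  refine Finset.sum_le_sum fun Q hQ => ?_
  have hQ' := mem_maximalSets.1 hQ
  rw [← mean_mul_measure (hμ Q hQ'.1)]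
  gcongr
  exact hQ'.2.1.le

lemma lintegral_maximalFunction_rpow_ne_top (hφ : ∀ Q ∈ F, φ Q ≠ ∞) {r : ℝ} (hr : 0 < r) :
    ∫⁻ x, maximalFunction F φ x ^ r ∂μ ≠ ∞ := by
  refine ne_top_of_le_ne_top ?_ (lintegral_mono fun x => maximalFunction_rpow_le_sum hr)
  rw [lintegral_finsetSum _ fun R hR => measurable_const.indicator (hF.measurableSet R hR)]
  refine ENNReal.sum_ne_top.2 fun R hR => ?_
  rw [lintegral_indicator_const (hF.measurableSet R hR)]
  exact ENNReal.mul_ne_top (ENNReal.rpow_ne_top_of_nonneg hr.le (hφ R hR)) (hμ R hR)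

theorem lintegral_maximalFunction_mean_rpow_le (hf : Measurable f) {r : ℝ} (hr : 1 < r) :
    ∫⁻ x, maximalFunction F (mean μ f) x ^ r ∂μ ≤ maximalConst r * ∫⁻ x, f x ^ r ∂μ := by
  rcases eq_or_ne (∫⁻ x, f x ^ r ∂μ) ∞ with hfr | hfr
  · rw [hfr, ENNReal.mul_top]
    · exact le_top
    · exact (ENNReal.rpow_pos_of_nonneg (by simp [pos_iff_ne_zero, geomConst_ne_zero])
        (by linarith)).ne'
  have hφ : ∀ Q ∈ F, mean μ f Q ≠ ∞ := fun Q hQ => mean_ne_top (hμ Q hQ) hf.aemeasurable hr hfr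
  exact lintegral_rpow_le_of_mul_measure_le hf (hF.measurable_maximalFunction _)
    (fun x => maximalFunction_ne_top hφ) hr
    (hF.lintegral_maximalFunction_rpow_ne_top hμ hφ (by linarith))
    (hF.mul_measure_lt_maximalFunction_le hμ f)

end IsNestedFamily

end MaximalFunction

section TreeOperators

variable {X : Type*} {F : Finset (Set X)} {φ ψ c lam : Set X → ℝ≥0∞} {t : ℝ≥0∞} {x : X}
  {Q R : Set X} {q : ℝ}

/-- The vector-valued function `(∑_{R ∈ F} (c_R 1_R) ^ q) ^ (1 / q)`. -/
noncomputable def treeSum (q : ℝ) (F : Finset (Set X)) (c : Set X → ℝ≥0∞) (x : X) : ℝ≥0∞ :=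
  (∑ R ∈ F, R.indicator (fun _ => c R ^ q) x) ^ (1 / q)

open Classical in
/-- The `ℓ ^ q` norm of `c` along the members of `F` containing `Q`. -/
noncomputable def chainNorm (q : ℝ) (F : Finset (Set X)) (c : Set X → ℝ≥0∞) (Q : Set X) : ℝ≥0∞ :=
  (∑ R ∈ F with Q ⊆ R, c R ^ q) ^ (1 / q)

open Classical in
/-- The members of `F` contained in `Q`. -/
noncomputable def subtree (F : Finset (Set X)) (Q : Set X) : Finset (Set X) :=
  F.filter (· ⊆ Q)

open Classical in
/-- The members of `F` all of whose strict ancestors satisfy `φ ≤ t`. The members of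
`maximalSets F φ t` are the least elements of this family, and it grows with `t`. -/
noncomputable def stage (F : Finset (Set X)) (φ : Set X → ℝ≥0∞) (t : ℝ≥0∞) : Finset (Set X) :=
  F.filter fun Q => ∀ R ∈ F, Q ⊂ R → φ R ≤ t

lemma mem_subtree : R ∈ subtree F Q ↔ R ∈ F ∧ R ⊆ Q := by
  simp [subtree]

lemma subtree_subset (F : Finset (Set X)) (Q : Set X) : subtree F Q ⊆ F := by
  classical exact Finset.filter_subset _ _

lemma subtree_mono {P : Set X} (h : Q ⊆ P) : subtree F Q ⊆ subtree F P := fun _ hR =>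
  mem_subtree.2 ((mem_subtree.1 hR).imp_right (·.trans h))

lemma mem_stage : Q ∈ stage F φ t ↔ Q ∈ F ∧ ∀ R ∈ F, Q ⊂ R → φ R ≤ t := by
  simp [stage]

lemma stage_subset (F : Finset (Set X)) (φ : Set X → ℝ≥0∞) (t : ℝ≥0∞) : stage F φ t ⊆ F := by
  classical exact Finset.filter_subset _ _

lemma monotone_stage (F : Finset (Set X)) (φ : Set X → ℝ≥0∞) : Monotone (stage F φ) :=
  fun _ _ hst _ hR => mem_stage.2 ((mem_stage.1 hR).imp_right fun h S hS hRS =>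
    (h S hS hRS).trans hst)

lemma maximalSets_subset_stage : maximalSets F φ t ⊆ stage F φ t := fun _ hQ =>
  mem_stage.2 ((mem_maximalSets.1 hQ).imp_right And.right)

lemma maximalFunction_mono_of_subset {G : Finset (Set X)} (h : G ⊆ F) :
    maximalFunction G ψ x ≤ maximalFunction F ψ x :=
  maximalFunction_le fun _ hR hx => le_maximalFunction (h hR) hx

lemma treeSum_rpow (hq : q ≠ 0) :
    treeSum q F c x ^ q = ∑ R ∈ F, R.indicator (fun _ => c R ^ q) x :=
  rpow_one_div_rpow hq _

lemma treeSum_mono_of_subset {G : Finset (Set X)} (h : G ⊆ F) (hq : 0 ≤ q) :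
    treeSum q G c x ≤ treeSum q F c x :=
  ENNReal.rpow_le_rpow (Finset.sum_le_sum_of_subset h) (by positivity)

lemma treeSum_ne_top (hq : 0 ≤ q) (hc : ∀ R ∈ F, c R ≠ ∞) : treeSum q F c x ≠ ∞ :=
  ENNReal.rpow_ne_top_of_nonneg (by positivity) (ENNReal.sum_ne_top.2 fun R hR =>
    ((indicator_le_self _ (fun _ => c R ^ q) x).trans_lt
      (ENNReal.rpow_ne_top_of_nonneg hq (hc R hR)).lt_top).ne)

lemma chainNorm_ne_top (hq : 0 ≤ q) (hc : ∀ R ∈ F, c R ≠ ∞) : chainNorm q F c Q ≠ ∞ := by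
  classical
  exact ENNReal.rpow_ne_top_of_nonneg (by positivity) (ENNReal.sum_ne_top.2 fun R hR =>
    ENNReal.rpow_ne_top_of_nonneg hq (hc R (Finset.mem_of_mem_filter R hR)))

lemma chainNorm_le_treeSum (hq : 0 ≤ q) (hx : x ∈ Q) : chainNorm q F c Q ≤ treeSum q F c x := by
  classical
  refine ENNReal.rpow_le_rpow ?_ (by positivity)
  rw [Finset.sum_filter]
  gcongr with R
  split_ifs with h
  · simp [h hx]
  · exact zero_le

/-- The extremiser `(c_R / treeSum q F c) ^ (q - 1) 1_R` in the `ℓ ^ q`–`ℓ ^ q'` duality. -/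
noncomputable def normingSeq (q : ℝ) (F : Finset (Set X)) (c : Set X → ℝ≥0∞) (R : Set X) (x : X) :
    ℝ≥0∞ :=
  R.indicator (fun x => c R ^ (q - 1) / treeSum q F c x ^ (q - 1)) x

lemma treeSum_le_sum_mul_normingSeq (hc : ∀ R ∈ F, c R ≠ ∞) (hq : 1 < q) (x : X) :
    treeSum q F c x ≤ ∑ R ∈ F, c R * normingSeq q F c R x := by
  have hq0 : 0 < q := by linarith
  have hq1 : 0 ≤ q - 1 := by linarith
  rcases eq_or_ne (treeSum q F c x) 0 with h0 | h0
  · rw [h0]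
    exact zero_le
  have hpow : treeSum q F c x ^ (q - 1) ≠ 0 :=
    (ENNReal.rpow_pos (pos_iff_ne_zero.2 h0) (treeSum_ne_top hq0.le hc)).ne'
  have hpow' : treeSum q F c x ^ (q - 1) ≠ ∞ :=
    ENNReal.rpow_ne_top_of_nonneg hq1 (treeSum_ne_top hq0.le hc)
  refine le_of_eq ?_
  calc treeSum q F c x = treeSum q F c x ^ q / treeSum q F c x ^ (q - 1) := by
        rw [ENNReal.eq_div_iff hpow hpow', rpow_sub_one_mul_self hq.le]
    _ = ∑ R ∈ F, R.indicator (fun _ => c R ^ q) x / treeSum q F c x ^ (q - 1) := by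
        simp_rw [treeSum_rpow hq0.ne', div_eq_mul_inv, Finset.sum_mul]
    _ = ∑ R ∈ F, c R * normingSeq q F c R x := by
        refine Finset.sum_congr rfl fun R _ => ?_
        by_cases hx : x ∈ R
        · simp only [normingSeq, indicator_of_mem hx]
          rw [← mul_div_assoc, mul_comm (c R), rpow_sub_one_mul_self hq.le]
        · simp [normingSeq, hx]

section Nested

variable [MeasurableSpace X]

lemma measurable_treeSum (h : ∀ R ∈ F, MeasurableSet R) (q : ℝ) (c : Set X → ℝ≥0∞) :
    Measurable (treeSum q F c) :=
  (Finset.measurable_fun_sum _ fun R hR => measurable_const.indicator (h R hR)).pow_const _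

namespace IsNestedFamily

variable (hF : IsNestedFamily (F : Set (Set X)))
include hF

lemma coe_subtree (Q : Set X) : IsNestedFamily (subtree F Q : Set (Set X)) :=
  hF.mono (Finset.coe_subset.2 (subtree_subset F Q))

lemma coe_stage (φ : Set X → ℝ≥0∞) (t : ℝ≥0∞) : IsNestedFamily (stage F φ t : Set (Set X)) :=
  hF.mono (Finset.coe_subset.2 (stage_subset F φ t))

lemma exists_least {P : Set X → Prop} (hx : ∀ R, P R → x ∈ R) (h : ∃ R ∈ F, P R) :
    ∃ R ∈ F, P R ∧ ∀ S ∈ F, P S → R ⊆ S := by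
  classical
  obtain ⟨R₀, hR₀, hP₀⟩ := h
  obtain ⟨R, -, hR⟩ := (F.filter P).exists_le_minimal (Finset.mem_filter.2 ⟨hR₀, hP₀⟩)
  have hRF := Finset.mem_filter.1 hR.prop
  refine ⟨R, hRF.1, hRF.2, fun S hS hPS => ?_⟩
  rcases hF.subset_or_ssubset hRF.1 hS (hx R hRF.2) (hx S hPS) with h | h
  · exact h
  · exact hR.le_of_le (Finset.mem_filter.2 ⟨hS, hPS⟩) h.subset

lemma maximalFunction_stage_le_ancestorSup (hQ : Q ∈ maximalSets F φ t) (hx : x ∈ Q) :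
    maximalFunction (stage F φ t) ψ x ≤ ancestorSup F ψ Q := by
  have hQ' := mem_maximalSets.1 hQ
  refine maximalFunction_le fun R hR hxR => ?_
  obtain ⟨hRF, hanc⟩ := mem_stage.1 hR
  rcases hF.subset_or_ssubset hQ'.1 hRF hx hxR with h | h
  · exact le_ancestorSup hRF h
  · exact absurd (hanc Q hQ'.1 h) hQ'.2.1.not_ge

lemma treeSum_eq_maximalFunction (hq : 0 < q) (c : Set X → ℝ≥0∞) (x : X) :
    treeSum q F c x = maximalFunction F (chainNorm q F c) x := by
  classical
  refine le_antisymm ?_ (maximalFunction_le fun R _ hx => chainNorm_le_treeSum hq.le hx)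
  by_cases h : ∃ R ∈ F, x ∈ R
  · obtain ⟨R, hR, hxR, hmin⟩ := hF.exists_least (fun _ => id) h
    refine le_trans (ENNReal.rpow_le_rpow ?_ (by positivity)) (le_maximalFunction hR hxR)
    rw [Finset.sum_filter]
    gcongr with S hS
    by_cases hx : x ∈ S
    · simp [hx, hmin S hS hx]
    · simp [hx]
  · push Not at h
    have hzero : ∑ R ∈ F, R.indicator (fun _ => c R ^ q) x = 0 :=
      Finset.sum_eq_zero fun R hR => by simp [h R hR]
    rw [treeSum, hzero, ENNReal.zero_rpow_of_pos (by positivity)]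
    exact zero_le

lemma lintegral_treeSum_rpow_ne_top {μ : Measure X} (hμ : ∀ Q ∈ F, μ Q ≠ ∞)
    (hc : ∀ R ∈ F, c R ≠ ∞) (hq : 0 < q) {p : ℝ} (hp : 0 < p) :
    ∫⁻ x, treeSum q F c x ^ p ∂μ ≠ ∞ := by
  simp_rw [hF.treeSum_eq_maximalFunction hq]
  exact hF.lintegral_maximalFunction_rpow_ne_top hμ (fun _ _ => chainNorm_ne_top hq.le hc) hp

lemma sum_ssuperset_rpow_le (hq : 0 < q) (hQ : Q ∈ maximalSets F (chainNorm q F c) t)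
    (hx : x ∈ Q) [DecidablePred (Q ⊂ ·)] : ∑ R ∈ F with Q ⊂ R, c R ^ q ≤ t ^ q := by
  classical
  by_cases h : ∃ R ∈ F, Q ⊂ R
  · obtain ⟨R, hR, hQR, hmin⟩ := hF.exists_least (fun _ h => h.subset hx) h
    calc ∑ S ∈ F with Q ⊂ S, c S ^ q ≤ ∑ S ∈ F with R ⊆ S, c S ^ q :=
          Finset.sum_le_sum_of_subset fun S hS => by
            rw [Finset.mem_filter] at hS ⊢
            exact ⟨hS.1, hmin S hS.1 hS.2⟩
      _ = chainNorm q F c R ^ q := (rpow_one_div_rpow hq.ne' _).symm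
      _ ≤ t ^ q := ENNReal.rpow_le_rpow ((mem_maximalSets.1 hQ).2.2 R hR hQR) hq.le
  · rw [Finset.filter_false_of_mem fun R hR hQR => h ⟨R, hR, hQR⟩]
    simp

lemma treeSum_rpow_le_subtree_add (hq : 0 < q) (hQ : Q ∈ maximalSets F (chainNorm q F c) t)
    (hx : x ∈ Q) : treeSum q F c x ^ q ≤ treeSum q (subtree F Q) c x ^ q + t ^ q := by
  classical
  rw [treeSum_rpow hq.ne', treeSum_rpow hq.ne', subtree,
    ← Finset.sum_filter_add_sum_filter_not F (· ⊆ Q)]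
  gcongr
  refine le_trans ?_ (hF.sum_ssuperset_rpow_le hq hQ hx)
  rw [Finset.sum_filter, Finset.sum_filter]
  gcongr with R hR
  by_cases hxR : x ∈ R
  · rcases hF.subset_or_ssubset hR (mem_maximalSets.1 hQ).1 hxR hx with h | h
    · simp [h]
    · simp [hxR, h, h.not_subset]
  · simp [hxR]

lemma le_treeSum_subtree (hq : 1 ≤ q) (hQ : Q ∈ maximalSets F (chainNorm q F c) t) (hx : x ∈ Q)
    (h : 2 * t < treeSum q F c x) : t ≤ treeSum q (subtree F Q) c x := by
  have hq0 : 0 < q := by linarith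
  by_contra! hlt
  refine (ENNReal.rpow_lt_rpow h hq0).not_ge ?_
  calc treeSum q F c x ^ q ≤ treeSum q (subtree F Q) c x ^ q + t ^ q :=
        hF.treeSum_rpow_le_subtree_add hq0 hQ hx
    _ ≤ 2 * t ^ q := by
        rw [two_mul]
        gcongr
    _ ≤ (2 * t) ^ q := two_mul_rpow_le hq t

end IsNestedFamily

end Nested

variable [MeasurableSpace X] {σ w : Measure X} {f : X → ℝ≥0∞} {a : Set X → X → ℝ≥0∞} {E : Set X}

/-- The coefficients `lam_R ∫_R f dσ` of the positive operator with weights `lam`, so that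
`treeSum q F (coeff lam σ f)` is the image of `f` under its `ℓ ^ q`-valued version. -/
noncomputable def coeff (lam : Set X → ℝ≥0∞) (σ : Measure X) (f : X → ℝ≥0∞) (R : Set X) : ℝ≥0∞ :=
  lam R * ∫⁻ x in R, f x ∂σ

/-- The dual operator `∑_{R ∈ F} lam_R (∫ a_R dw) 1_R`. -/
noncomputable def dualSum (F : Finset (Set X)) (lam : Set X → ℝ≥0∞) (w : Measure X)
    (a : Set X → X → ℝ≥0∞) (x : X) : ℝ≥0∞ :=
  ∑ R ∈ F, R.indicator (fun _ => lam R * ∫⁻ y, a R y ∂w) x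

/-- The sequences `a` with `a_R` supported in `R` and `ℓ ^ q'` norm at most one at every point,
which are the finite counterpart of the class `MemB`. -/
structure IsSubunitSeq (q : ℝ) (F : Finset (Set X)) (a : Set X → X → ℝ≥0∞) : Prop where
  measurable : ∀ R ∈ F, Measurable (a R)
  support_subset : ∀ R ∈ F, Function.support (a R) ⊆ R
  sum_rpow_le_one : ∀ x, ∑ R ∈ F, a R x ^ q.conjExponent ≤ 1

lemma measurable_dualSum (h : ∀ R ∈ F, MeasurableSet R) (lam : Set X → ℝ≥0∞) (w : Measure X)
    (a : Set X → X → ℝ≥0∞) : Measurable (dualSum F lam w a) :=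
  Finset.measurable_fun_sum _ fun R hR => measurable_const.indicator (h R hR)

lemma sum_coeff_mul_lintegral (hF : ∀ R ∈ F, MeasurableSet R) (hFQ : ∀ R ∈ F, R ⊆ Q)
    (lam : Set X → ℝ≥0∞) (hf : Measurable f) (a : Set X → X → ℝ≥0∞) :
    ∑ R ∈ F, coeff lam σ f R * ∫⁻ y, a R y ∂w = ∫⁻ x in Q, f x * dualSum F lam w a x ∂σ := by
  simp_rw [dualSum, Finset.mul_sum]
  rw [lintegral_finsetSum _ fun R hR => by exact hf.mul (measurable_const.indicator (hF R hR))]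
  refine Finset.sum_congr rfl fun R hR => ?_
  simp_rw [← indicator_mul_right]
  rw [setLIntegral_indicator (hF R hR), inter_eq_left.2 (hFQ R hR), lintegral_mul_const _ hf, coeff]
  ring

namespace IsSubunitSeq

lemma indicator (ha : IsSubunitSeq q F a) (hq : 1 < q) (hE : MeasurableSet E) :
    IsSubunitSeq q F fun R => E.indicator (a R) where
  measurable R hR := (ha.measurable R hR).indicator hE
  support_subset R hR := by
    rw [support_indicator]
    exact inter_subset_right.trans (ha.support_subset R hR)
  sum_rpow_le_one x := by
    have := (Real.HolderConjugate.conjExponent hq).symm.nonneg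
    refine le_trans ?_ (ha.sum_rpow_le_one x)
    gcongr
    exact indicator_le_self _ _ _

lemma sum_mul_le_treeSum (ha : IsSubunitSeq q F a) (hq : 1 < q) (b : Set X → ℝ≥0∞) (x : X) :
    ∑ R ∈ F, b R * a R x ≤ treeSum q F b x := by
  have hc := Real.HolderConjugate.conjExponent hq
  calc ∑ R ∈ F, b R * a R x = ∑ R ∈ F, R.indicator (fun _ => b R) x * a R x := by
        refine Finset.sum_congr rfl fun R hR => ?_
        by_cases hx : x ∈ R
        · simp [hx]
        · simp [hx, Function.notMem_support.1 fun h => hx (ha.support_subset R hR h)]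
    _ ≤ (∑ R ∈ F, R.indicator (fun _ => b R) x ^ q) ^ (1 / q) *
          (∑ R ∈ F, a R x ^ q.conjExponent) ^ (1 / q.conjExponent) :=
        ENNReal.inner_le_Lp_mul_Lq F _ _ hc
    _ ≤ (∑ R ∈ F, R.indicator (fun _ => b R) x ^ q) ^ (1 / q) * 1 := by
        gcongr
        exact ENNReal.rpow_le_one (ha.sum_rpow_le_one x) hc.symm.one_div_nonneg
    _ = treeSum q F b x := by
        rw [mul_one, treeSum]
        congr 2 with R
        by_cases hx : x ∈ R <;> simp [hx, hc.pos]

lemma sum_mul_lintegral_le (ha : IsSubunitSeq q F a) (hq : 1 < q) (b : Set X → ℝ≥0∞) :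
    ∑ R ∈ F, b R * ∫⁻ y, a R y ∂w ≤ ∫⁻ y, treeSum q F b y ∂w := by
  calc ∑ R ∈ F, b R * ∫⁻ y, a R y ∂w = ∫⁻ y, ∑ R ∈ F, b R * a R y ∂w := by
        rw [lintegral_finsetSum _ fun R hR => (ha.measurable R hR).const_mul _]
        exact Finset.sum_congr rfl fun R hR => (lintegral_const_mul _ (ha.measurable R hR)).symm
    _ ≤ ∫⁻ y, treeSum q F b y ∂w := lintegral_mono fun y => ha.sum_mul_le_treeSum hq b y

end IsSubunitSeq

lemma isSubunitSeq_normingSeq (hF : ∀ R ∈ F, MeasurableSet R) (hq : 1 < q) (c : Set X → ℝ≥0∞) :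
    IsSubunitSeq q F (normingSeq q F c) where
  measurable R hR :=
    (measurable_const.div ((measurable_treeSum hF q c).pow_const _)).indicator (hF R hR)
  support_subset R _ := support_indicator_subset
  sum_rpow_le_one x := by
    have hc := Real.HolderConjugate.conjExponent hq
    calc ∑ R ∈ F, normingSeq q F c R x ^ q.conjExponent
        = ∑ R ∈ F, R.indicator (fun _ => c R ^ q) x / treeSum q F c x ^ q := by
          refine Finset.sum_congr rfl fun R _ => ?_
          by_cases hx : x ∈ R
          · simp only [normingSeq, indicator_of_mem hx]
            rw [ENNReal.div_rpow_of_nonneg _ _ hc.symm.nonneg, ← ENNReal.rpow_mul,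
              ← ENNReal.rpow_mul, hc.sub_one_mul_conj]
          · simp [normingSeq, hx, hc.symm.pos]
      _ = treeSum q F c x ^ q / treeSum q F c x ^ q := by
          simp_rw [treeSum_rpow hc.ne_zero, div_eq_mul_inv, Finset.sum_mul]
      _ ≤ 1 := ENNReal.div_self_le_one

end TreeOperators

section GoodLambda

variable {X : Type*} {F : Finset (Set X)} {φ c lam : Set X → ℝ≥0∞} {s t B : ℝ≥0∞} {x : X}
  {E Q R : Set X} {p q r : ℝ} [MeasurableSpace X] {σ w : Measure X} {f h : X → ℝ≥0∞}
  {a : Set X → X → ℝ≥0∞}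

/-- The testing condition, with constant `B`, for the dual operator on a finite family. -/
def DualTest (F : Finset (Set X)) (lam : Set X → ℝ≥0∞) (σ w : Measure X) (p q r : ℝ)
    (B : ℝ≥0∞) : Prop :=
  ∀ Q ∈ F, ∀ a : Set X → X → ℝ≥0∞, IsSubunitSeq q (subtree F Q) a →
    ∫⁻ x in Q, dualSum (subtree F Q) lam w a x ^ r.conjExponent ∂σ ≤
      B * w Q ^ (r.conjExponent / p.conjExponent)

/-- The maximal function of `ψ` over stage `s` where it more than doubles the one over stage `t`,
and zero elsewhere. -/
noncomputable def freshMean (F : Finset (Set X)) (φ ψ : Set X → ℝ≥0∞) (t s : ℝ≥0∞) (x : X) :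
    ℝ≥0∞ :=
  if 2 * maximalFunction (stage F φ t) ψ x < maximalFunction (stage F φ s) ψ x
  then maximalFunction (stage F φ s) ψ x else 0

/-- The part of `f` outside `{s < maximalFunction F φ}`, together with the means of `f` that more
than double between the stages `t` and `s`. In the good-`λ` inequality at the heights `t < s`, it
is what remains of `f` after the means already present at stage `t` are split off. -/
noncomputable def freshPart (F : Finset (Set X)) (φ : Set X → ℝ≥0∞) (σ : Measure X)
    (f : X → ℝ≥0∞) (t s : ℝ≥0∞) (x : X) : ℝ≥0∞ :=
  {y | s < maximalFunction F φ y}ᶜ.indicator f x + freshMean F φ (mean σ f) t s x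

lemma DualTest.sum_coeff_mul_lintegral_le (hB : DualTest F lam σ w p q r B)
    (hF : ∀ R ∈ F, MeasurableSet R) (hr : 1 < r) (hQ : Q ∈ F)
    (ha : IsSubunitSeq q (subtree F Q) a) (hh : Measurable h) :
    ∑ R ∈ subtree F Q, coeff lam σ h R * ∫⁻ y, a R y ∂w ≤
      (∫⁻ x in Q, h x ^ r ∂σ) ^ (1 / r) *
        (B * w Q ^ (r.conjExponent / p.conjExponent)) ^ (1 / r.conjExponent) := by
  have hc := Real.HolderConjugate.conjExponent hr
  have hsub : ∀ R ∈ subtree F Q, MeasurableSet R := fun R hR => hF R (mem_subtree.1 hR).1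
  rw [sum_coeff_mul_lintegral hsub (fun R hR => (mem_subtree.1 hR).2) lam hh]
  refine (ENNReal.lintegral_mul_le_Lp_mul_Lq _ hc hh.aemeasurable
    (measurable_dualSum hsub lam w a).aemeasurable).trans ?_
  have := hc.symm.one_div_nonneg
  gcongr
  exact hB Q hQ a ha

lemma setLIntegral_treeSum_le_sum (hF : ∀ R ∈ F, MeasurableSet R) (hc : ∀ R ∈ F, c R ≠ ∞)
    (hq : 1 < q) (E : Set X) :
    ∫⁻ x in E, treeSum q F c x ∂w ≤ ∑ R ∈ F, c R * ∫⁻ y in E, normingSeq q F c R y ∂w := by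
  have hm := fun R hR => (isSubunitSeq_normingSeq hF hq c).measurable R hR
  simp_rw [← Finset.sum_congr rfl fun R hR => lintegral_const_mul (c R) (hm R hR)]
  rw [← lintegral_finsetSum _ fun R hR => (hm R hR).const_mul _]
  exact lintegral_mono fun x => treeSum_le_sum_mul_normingSeq hc hq x

namespace IsNestedFamily

variable (hF : IsNestedFamily (F : Set (Set X)))
include hF

lemma measurable_freshMean (φ ψ : Set X → ℝ≥0∞) (t s : ℝ≥0∞) :
    Measurable (freshMean F φ ψ t s) := by
  have hM := fun t => (hF.coe_stage φ t).measurable_maximalFunction ψ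
  exact Measurable.ite (measurableSet_lt ((hM t).const_mul 2) (hM s)) (hM s) measurable_const

lemma measurable_freshPart (φ : Set X → ℝ≥0∞) (σ : Measure X) (hf : Measurable f)
    (t s : ℝ≥0∞) : Measurable (freshPart F φ σ f t s) :=
  (hf.indicator (hF.measurableSet_lt_maximalFunction φ s).compl).add
    (hF.measurable_freshMean φ _ t s)

lemma setLIntegral_inter_le_maximalFunction_stage (hσ : ∀ Q ∈ F, σ Q ≠ ∞) (f : X → ℝ≥0∞)
    (hR : R ∈ F) (hx : x ∈ R) (hxs : maximalFunction F φ x ≤ s) :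
    ∫⁻ y in R ∩ {y | s < maximalFunction F φ y}, f y ∂σ ≤
      ∫⁻ y in R, maximalFunction (stage F φ s) (mean σ f) y ∂σ := by
  classical
  set G := (maximalSets F φ s).filter (· ⊆ R)
  have hGm : ∀ Q ∈ G, MeasurableSet Q := fun Q hQ =>
    hF.measurableSet_of_mem_maximalSets (Finset.mem_of_mem_filter Q hQ)
  have hGd : (G : Set (Set X)).PairwiseDisjoint fun Q => Q :=
    (hF.pairwiseDisjoint_maximalSets φ s).subset (Finset.coe_subset.2 (Finset.filter_subset _ _))
  have hcover : R ∩ {y | s < maximalFunction F φ y} ⊆ ⋃ Q ∈ G, Q := by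
    rintro y ⟨hyR, hy⟩
    obtain ⟨Q, hQ, hyQ⟩ := lt_maximalFunction_iff.1 hy
    rcases hF.subset_or_ssubset (maximalSets_subset F φ s hQ) hR hyQ hyR with h | h
    · exact mem_iUnion₂.2 ⟨Q, Finset.mem_filter.2 ⟨hQ, h⟩, hyQ⟩
    · exact absurd (lt_maximalFunction_iff.2 ⟨Q, hQ, h.subset hx⟩) hxs.not_gt
  calc ∫⁻ y in R ∩ {y | s < maximalFunction F φ y}, f y ∂σ
      ≤ ∑ Q ∈ G, ∫⁻ y in Q, f y ∂σ :=
        (lintegral_mono_set hcover).trans_eq (lintegral_biUnion_finset hGd hGm f)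
    _ ≤ ∑ Q ∈ G, ∫⁻ y in Q, maximalFunction (stage F φ s) (mean σ f) y ∂σ := by
        refine Finset.sum_le_sum fun Q hQ => ?_
        have hQs := Finset.mem_of_mem_filter Q hQ
        rw [← mean_mul_measure (hσ Q (maximalSets_subset F φ s hQs)), ← setLIntegral_const]
        exact setLIntegral_mono' (hGm Q hQ) fun y hy =>
          le_maximalFunction (maximalSets_subset_stage hQs) hy
    _ ≤ _ := by
        rw [← lintegral_biUnion_finset hGd hGm]
        exact lintegral_mono_set (iUnion₂_subset fun Q hQ => (Finset.mem_filter.1 hQ).2)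

lemma setLIntegral_le_freshPart_add (hσ : ∀ Q ∈ F, σ Q ≠ ∞) (hf : Measurable f)
    (hQ : Q ∈ maximalSets F φ t) (hR : R ∈ F) (hRQ : R ⊆ Q) (hx : x ∈ R)
    (hxs : maximalFunction F φ x ≤ s) :
    ∫⁻ y in R, f y ∂σ ≤
      ∫⁻ y in R, freshPart F φ σ f t s y ∂σ + 2 * ancestorSup F (mean σ f) Q * σ R := by
  have hΩ := hF.measurableSet_lt_maximalFunction φ s
  rw [← setLIntegral_const, ← lintegral_add_left (hF.measurable_freshPart φ σ hf t s),
    ← lintegral_inter_add_sdiff f R hΩ, add_comm]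
  calc ∫⁻ y in R \ {y | s < maximalFunction F φ y}, f y ∂σ +
        ∫⁻ y in R ∩ {y | s < maximalFunction F φ y}, f y ∂σ
      ≤ ∫⁻ y in R, {y | s < maximalFunction F φ y}ᶜ.indicator f y ∂σ +
          ∫⁻ y in R, maximalFunction (stage F φ s) (mean σ f) y ∂σ := by
        rw [setLIntegral_indicator hΩ.compl, inter_comm _ R, ← sdiff_eq]
        exact add_le_add le_rfl (hF.setLIntegral_inter_le_maximalFunction_stage hσ f hR hx hxs)
    _ = ∫⁻ y in R, {y | s < maximalFunction F φ y}ᶜ.indicator f y +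
          maximalFunction (stage F φ s) (mean σ f) y ∂σ :=
        (lintegral_add_left (hf.indicator hΩ.compl) _).symm
    _ ≤ _ := by
        refine setLIntegral_mono' (hF.measurableSet R hR) fun y hy => ?_
        have hm := hF.maximalFunction_stage_le_ancestorSup (ψ := mean σ f) hQ (hRQ hy)
        rw [freshPart, freshMean, add_assoc]
        gcongr
        split_ifs with hlt
        · exact le_self_add
        · rw [zero_add]
          exact (not_lt.1 hlt).trans (by gcongr)

lemma sum_coeff_mul_lintegral_le (hσ : ∀ Q ∈ F, σ Q ≠ ∞) (hf : Measurable f)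
    (hQ : Q ∈ maximalSets F φ t) (ha : ∀ R ∈ subtree F Q, Function.support (a R) ⊆ R)
    (hE : MeasurableSet E) (hEs : ∀ x ∈ E, maximalFunction F φ x ≤ s) :
    ∑ R ∈ subtree F Q, coeff lam σ f R * ∫⁻ y in E, a R y ∂w ≤
      ∑ R ∈ subtree F Q,
          coeff lam σ (freshPart F φ σ f t s) R * ∫⁻ y in E, a R y ∂w +
        2 * ancestorSup F (mean σ f) Q *
          ∑ R ∈ subtree F Q, lam R * σ R * ∫⁻ y in E, a R y ∂w := by
  rw [Finset.mul_sum, ← Finset.sum_add_distrib]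
  refine Finset.sum_le_sum fun R hR => ?_
  obtain ⟨hRF, hRQ⟩ := mem_subtree.1 hR
  by_cases hRE : ∃ y ∈ R, y ∈ E
  · obtain ⟨y, hyR, hyE⟩ := hRE
    calc coeff lam σ f R * ∫⁻ y in E, a R y ∂w
        ≤ lam R * (∫⁻ y in R, freshPart F φ σ f t s y ∂σ + 2 * ancestorSup F (mean σ f) Q * σ R) *
            ∫⁻ y in E, a R y ∂w := by
          rw [coeff]
          gcongr
          exact hF.setLIntegral_le_freshPart_add hσ hf hQ hRF hRQ hyR (hEs y hyE)
      _ = _ := by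
          rw [coeff]
          ring
  · push Not at hRE
    have hzero : ∫⁻ y in E, a R y ∂w = 0 :=
      setLIntegral_eq_zero hE fun y hy => Function.notMem_support.1 fun h => hRE y (ha R hR h) hy
    simp [hzero]

-- Good-`λ`: on `E` the tree below `Q` contributes at least `t`. Dualise it against the norming
-- sequence restricted to `E`; the fresh part of `f` is controlled by the dual test, and the rest
-- of `f` is at most a constant on `Q`.
lemma mul_measure_le (hσ : ∀ Q ∈ F, σ Q ≠ ∞) (hr : 1 < r) (hq : 1 < q)
    (hB : DualTest F lam σ w p q r B) (hf : Measurable f) (hc : ∀ R ∈ F, coeff lam σ f R ≠ ∞)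
    (hQ : Q ∈ maximalSets F (chainNorm q F (coeff lam σ f)) t) (hE : MeasurableSet E)
    (hEQ : E ⊆ Q) (hEt : ∀ x ∈ E, 2 * t < treeSum q F (coeff lam σ f) x)
    (hEs : ∀ x ∈ E, treeSum q F (coeff lam σ f) x ≤ s) :
    t * w E ≤
      (∫⁻ x in Q, freshPart F (chainNorm q F (coeff lam σ f)) σ f t s x ^ r ∂σ) ^ (1 / r) *
          (B * w Q ^ (r.conjExponent / p.conjExponent)) ^ (1 / r.conjExponent) +
        2 * ancestorSup F (mean σ f) Q *
          ∫⁻ x in E, treeSum q (subtree F Q) (fun R => lam R * σ R) x ∂w := by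
  set G := subtree F Q
  set c := coeff lam σ f
  have hGm : ∀ R ∈ G, MeasurableSet R := (hF.coe_subtree Q).measurableSet
  have ha := isSubunitSeq_normingSeq hGm hq c
  simp_rw [hF.treeSum_eq_maximalFunction (zero_lt_one.trans hq)] at hEs
  calc t * w E = ∫⁻ _ in E, t ∂w := (setLIntegral_const _ _).symm
    _ ≤ ∫⁻ x in E, treeSum q G c x ∂w := setLIntegral_mono' hE fun x hx =>
        hF.le_treeSum_subtree hq.le hQ (hEQ hx) (hEt x hx)
    _ ≤ ∑ R ∈ G, c R * ∫⁻ y in E, normingSeq q G c R y ∂w :=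
        setLIntegral_treeSum_le_sum hGm (fun R hR => hc R (subtree_subset F Q hR)) hq E
    _ ≤ _ := hF.sum_coeff_mul_lintegral_le hσ hf hQ ha.support_subset hE hEs
    _ ≤ _ := by
        gcongr
        · simp_rw [← lintegral_indicator hE]
          exact hB.sum_coeff_mul_lintegral_le hF.measurableSet hr (maximalSets_subset _ _ _ hQ)
            (ha.indicator hq hE) (hF.measurable_freshPart _ σ hf t s)
        · exact ha.sum_mul_lintegral_le hq _

end IsNestedFamily

end GoodLambda

section TwoWeight

variable {X : Type*} {F : Finset (Set X)} {ψ b φ lam : Set X → ℝ≥0∞} {A : ℝ≥0∞} {x : X}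
  {Q : Set X} {p q r : ℝ}

/-- The majorant `∑_j ∑_P 2 ^ ((j + 1) p) (treeSum q (subtree F P) b) ^ p 1_P`, with `P` ranging
over the maximal sets where `ψ` exceeds `2 ^ j`, of `(ancestorSup F ψ Q * treeSum q (subtree F Q) b)
^ p` on `Q`, for all `Q` at once. -/
noncomputable def principalMajorant (F : Finset (Set X)) (ψ b : Set X → ℝ≥0∞) (p q : ℝ) (x : X) :
    ℝ≥0∞ :=
  ∑' j : ℤ, ∑ P ∈ maximalSets F ψ (2 ^ j),
    P.indicator (fun x => ((2 : ℝ≥0∞) ^ (j + 1)) ^ p * treeSum q (subtree F P) b x ^ p) x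

lemma ancestorSup_mul_rpow_le_principalMajorant (hψ : ∀ Q ∈ F, ψ Q ≠ ∞) (hp : 0 < p) (hq : 0 ≤ q)
    (hx : x ∈ Q) :
    (ancestorSup F ψ Q * treeSum q (subtree F Q) b x) ^ p ≤ principalMajorant F ψ b p q x := by
  rcases eq_or_ne (ancestorSup F ψ Q) 0 with h0 | h0
  · simp [h0, hp]
  obtain ⟨n, hn, hn'⟩ :=
    ENNReal.exists_mem_Ioc_zpow h0 (ancestorSup_ne_top hψ) ENNReal.one_lt_two (by simp)
  obtain ⟨R, hR, hQR, hnR⟩ := lt_ancestorSup_iff.1 hn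
  obtain ⟨P, hP, hRP⟩ := exists_maximalSets_superset hR hnR
  refine le_trans ?_ (ENNReal.le_tsum n)
  refine le_trans ?_ (Finset.single_le_sum (fun _ _ => zero_le) hP)
  rw [indicator_of_mem (hRP (hQR hx)), ← ENNReal.mul_rpow_of_nonneg _ _ hp.le]
  gcongr
  exact treeSum_mono_of_subset (subtree_mono (hQR.trans hRP)) hq

/-- The constant in the estimate for the sum of the fresh parts. -/
noncomputable def freshConst (r : ℝ) : ℝ≥0∞ := 2 ^ (r - 1) * (2 + 4 * maximalConst r)

/-- The constant in the estimate for the principal majorant of the means. -/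
noncomputable def principalConst (r : ℝ) : ℝ≥0∞ := 2 ^ r * (geomConst r * maximalConst r)

/-- The proportion of the weight of a set below which its part in a layer is absorbed. -/
noncomputable def absorbRatio (p : ℝ) : ℝ≥0∞ := (2 * (4 ^ p * geomConst p))⁻¹

/-- The constant in the two-weight inequality on finite families. -/
noncomputable def twoWeightConst (p r : ℝ) : ℝ≥0∞ :=
  2 * (4 ^ p * (2 ^ (p - 1) * ((absorbRatio p)⁻¹ ^ (p - 1) * freshConst r ^ (p / r) +
    2 ^ p * principalConst r ^ (p / r))))

lemma freshConst_ne_top (hr : 1 < r) : freshConst r ≠ ∞ := by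
  have := maximalConst_ne_top hr
  have : 0 ≤ r - 1 := by linarith
  unfold freshConst
  finiteness

lemma principalConst_ne_top (hr : 1 < r) : principalConst r ≠ ∞ := by
  have := maximalConst_ne_top hr
  have hr0 : 0 < r := by linarith
  have := geomConst_ne_top hr0
  unfold principalConst
  finiteness

lemma absorbRatio_ne_zero (hp : 0 < p) : absorbRatio p ≠ 0 := by
  have := geomConst_ne_top hp
  exact ENNReal.inv_ne_zero.2 (by finiteness)

lemma absorbRatio_ne_top (p : ℝ) : absorbRatio p ≠ ∞ := by
  have : (4 : ℝ≥0∞) ^ p ≠ 0 := (ENNReal.rpow_pos (by norm_num) (by simp)).ne'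
  simp [absorbRatio, geomConst_ne_zero, this]

lemma absorbRatio_mul (hp : 0 < p) (I : ℝ≥0∞) :
    4 ^ p * (absorbRatio p * (geomConst p * I)) = I / 2 := by
  have h0 : (4 : ℝ≥0∞) ^ p * geomConst p ≠ 0 :=
    mul_ne_zero (ENNReal.rpow_pos (by norm_num) (by simp)).ne' (geomConst_ne_zero p)
  have ht : (4 : ℝ≥0∞) ^ p * geomConst p ≠ ∞ := by
    have := geomConst_ne_top hp
    finiteness
  calc (4 : ℝ≥0∞) ^ p * (absorbRatio p * (geomConst p * I))
      = 2⁻¹ * ((4 ^ p * geomConst p)⁻¹ * (4 ^ p * geomConst p)) * I := by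
        rw [absorbRatio, ENNReal.mul_inv (Or.inl (by simp)) (Or.inl (by simp))]
        ring
    _ = I / 2 := by rw [ENNReal.inv_mul_cancel h0 ht, mul_one, mul_comm, div_eq_mul_inv]

lemma twoWeightConst_ne_top (hr : 1 < r) (hrp : r ≤ p) : twoWeightConst p r ≠ ∞ := by
  have hp : 0 < p := by linarith
  have hp1 : 0 ≤ p - 1 := by linarith
  have hpr : 0 ≤ p / r := div_nonneg hp.le (by linarith)
  have := freshConst_ne_top hr
  have := principalConst_ne_top hr
  have := ENNReal.inv_ne_top.2 (absorbRatio_ne_zero hp)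
  unfold twoWeightConst
  finiteness

variable [MeasurableSpace X] {σ w : Measure X} {f : X → ℝ≥0∞}

/-- The testing condition, with constant `A`, for the `ℓ ^ q`-valued operator with weights `lam`
on a finite family. -/
def DirectTest (F : Finset (Set X)) (lam : Set X → ℝ≥0∞) (σ w : Measure X) (p q r : ℝ)
    (A : ℝ≥0∞) : Prop :=
  ∀ Q ∈ F, ∫⁻ x in Q, treeSum q (subtree F Q) (fun R => lam R * σ R) x ^ p ∂w ≤ A * σ Q ^ (p / r)

lemma coeff_ne_top (hσ : ∀ Q ∈ F, σ Q ≠ ∞) (hlam : ∀ Q ∈ F, lam Q ≠ ∞) (hf : AEMeasurable f σ)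
    (hr : 1 < r) (hfr : ∫⁻ x, f x ^ r ∂σ ≠ ∞) (hQ : Q ∈ F) : coeff lam σ f Q ≠ ∞ :=
  ENNReal.mul_ne_top (hlam Q hQ) (setLIntegral_ne_top_of_rpow (hσ Q hQ) hf hr hfr)

namespace IsNestedFamily

variable (hF : IsNestedFamily (F : Set (Set X)))
include hF

lemma setLIntegral_freshPart_rpow_le (hf : Measurable f) (hr : 1 ≤ r) (s t : ℝ≥0∞) :
    ∫⁻ x in {x | t < maximalFunction F φ x}, freshPart F φ σ f t s x ^ r ∂σ ≤
      2 ^ (r - 1) * (∫⁻ x in maximalFunction F φ ⁻¹' Ioc t s, f x ^ r ∂σ +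
        ∫⁻ x, freshMean F φ (mean σ f) t s x ^ r ∂σ) := by
  have hr0 : 0 < r := by linarith
  have hS := hF.measurableSet_lt_maximalFunction φ
  have hfresh := (hF.measurable_freshMean φ (mean σ f) t s).pow_const r
  have hIoc : maximalFunction F φ ⁻¹' Ioc t s =
      {x | s < maximalFunction F φ x}ᶜ ∩ {x | t < maximalFunction F φ x} := by
    ext x
    simp [and_comm]
  calc ∫⁻ x in {x | t < maximalFunction F φ x}, freshPart F φ σ f t s x ^ r ∂σ
      ≤ ∫⁻ x in {x | t < maximalFunction F φ x},
          2 ^ (r - 1) * ({x | s < maximalFunction F φ x}ᶜ.indicator (fun x => f x ^ r) x +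
            freshMean F φ (mean σ f) t s x ^ r) ∂σ := by
        refine lintegral_mono fun x => (ENNReal.rpow_add_le_mul_rpow_add_rpow _ _ hr).trans ?_
        gcongr
        by_cases hx : s < maximalFunction F φ x <;> simp [hx, hr0]
    _ = 2 ^ (r - 1) * (∫⁻ x in maximalFunction F φ ⁻¹' Ioc t s, f x ^ r ∂σ +
          ∫⁻ x in {x | t < maximalFunction F φ x}, freshMean F φ (mean σ f) t s x ^ r ∂σ) := by
        rw [lintegral_const_mul _ (by exact ((hf.pow_const r).indicator (hS s).compl).add hfresh),
          lintegral_add_right _ hfresh, setLIntegral_indicator (hS s).compl, hIoc]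
    _ ≤ _ := by
        gcongr
        exact Measure.restrict_le_self

lemma tsum_lintegral_freshMean_rpow_le {ψ : Set X → ℝ≥0∞} (hψ : ∀ Q ∈ F, ψ Q ≠ ∞) (hr : 1 ≤ r) :
    ∑' k : ℤ, ∫⁻ x, freshMean F φ ψ (2 ^ k) (2 ^ (k + 2)) x ^ r ∂σ ≤
      4 * ∫⁻ x, maximalFunction F ψ x ^ r ∂σ := by
  rw [← lintegral_tsum fun k => ((hF.measurable_freshMean φ ψ _ _).pow_const r).aemeasurable,
    ← lintegral_const_mul _ ((hF.measurable_maximalFunction ψ).pow_const r)]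
  refine lintegral_mono fun x => ?_
  exact tsum_doubling_rpow_le (β := fun k => maximalFunction (stage F φ (2 ^ k)) ψ x)
    (fun i j h => maximalFunction_mono_of_subset (monotone_stage F φ (monotone_two_zpow h)))
    (maximalFunction_ne_top hψ) (fun k => maximalFunction_mono_of_subset (stage_subset F φ _)) hr

lemma tsum_setLIntegral_freshPart_rpow_le (hσ : ∀ Q ∈ F, σ Q ≠ ∞) (hf : Measurable f) (hr : 1 < r)
    (hfr : ∫⁻ x, f x ^ r ∂σ ≠ ∞) :
    ∑' k : ℤ, ∫⁻ x in {x | 2 ^ k < maximalFunction F φ x},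
        freshPart F φ σ f (2 ^ k) (2 ^ (k + 2)) x ^ r ∂σ ≤ freshConst r * ∫⁻ x, f x ^ r ∂σ := by
  have hmean : ∀ Q ∈ F, mean σ f Q ≠ ∞ := fun Q hQ =>
    mean_ne_top (hσ Q hQ) hf.aemeasurable hr hfr
  calc ∑' k : ℤ, ∫⁻ x in {x | 2 ^ k < maximalFunction F φ x},
        freshPart F φ σ f (2 ^ k) (2 ^ (k + 2)) x ^ r ∂σ
      ≤ ∑' k : ℤ, 2 ^ (r - 1) *
          (∫⁻ x in maximalFunction F φ ⁻¹' Ioc (2 ^ k) (2 ^ (k + 2)), f x ^ r ∂σ +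
            ∫⁻ x, freshMean F φ (mean σ f) (2 ^ k) (2 ^ (k + 2)) x ^ r ∂σ) :=
        ENNReal.tsum_le_tsum fun k => hF.setLIntegral_freshPart_rpow_le hf hr.le _ _
    _ ≤ 2 ^ (r - 1) * (2 * ∫⁻ x, f x ^ r ∂σ + 4 * (maximalConst r * ∫⁻ x, f x ^ r ∂σ)) := by
        rw [ENNReal.tsum_mul_left, ENNReal.tsum_add]
        gcongr
        · exact tsum_setLIntegral_Ioc_le (hF.measurable_maximalFunction φ) _
        · refine (hF.tsum_lintegral_freshMean_rpow_le hmean hr.le).trans ?_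
          gcongr
          exact hF.lintegral_maximalFunction_mean_rpow_le hσ hf hr
    _ = freshConst r * ∫⁻ x, f x ^ r ∂σ := by
        rw [freshConst]
        ring

lemma tsum_sum_setLIntegral_freshPart_rpow_le (hσ : ∀ Q ∈ F, σ Q ≠ ∞) (hf : Measurable f)
    (hr : 1 < r) (hrp : r ≤ p) (hfr : ∫⁻ x, f x ^ r ∂σ ≠ ∞) :
    ∑' k : ℤ, ∑ Q ∈ maximalSets F φ (2 ^ k),
        (∫⁻ x in Q, freshPart F φ σ f (2 ^ k) (2 ^ (k + 2)) x ^ r ∂σ) ^ (p / r) ≤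
      (freshConst r * ∫⁻ x, f x ^ r ∂σ) ^ (p / r) := by
  have hpr : 1 ≤ p / r := (one_le_div (by linarith)).2 hrp
  calc ∑' k : ℤ, ∑ Q ∈ maximalSets F φ (2 ^ k),
        (∫⁻ x in Q, freshPart F φ σ f (2 ^ k) (2 ^ (k + 2)) x ^ r ∂σ) ^ (p / r)
      ≤ ∑' k : ℤ, (∫⁻ x in {x | 2 ^ k < maximalFunction F φ x},
          freshPart F φ σ f (2 ^ k) (2 ^ (k + 2)) x ^ r ∂σ) ^ (p / r) := by
        refine ENNReal.tsum_le_tsum fun k => (sum_rpow_le_rpow_sum _ _ hpr).trans ?_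
        rw [hF.sum_setLIntegral_maximalSets]
    _ ≤ (∑' k : ℤ, ∫⁻ x in {x | 2 ^ k < maximalFunction F φ x},
          freshPart F φ σ f (2 ^ k) (2 ^ (k + 2)) x ^ r ∂σ) ^ (p / r) :=
        tsum_rpow_le_rpow_tsum _ hpr
    _ ≤ _ := by
        gcongr
        exact hF.tsum_setLIntegral_freshPart_rpow_le hσ hf hr hfr

lemma lintegral_principalMajorant (ψ b : Set X → ℝ≥0∞) (p q : ℝ) :
    ∫⁻ x, principalMajorant F ψ b p q x ∂w =
      ∑' j : ℤ, ∑ P ∈ maximalSets F ψ (2 ^ j),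
        ((2 : ℝ≥0∞) ^ (j + 1)) ^ p * ∫⁻ x in P, treeSum q (subtree F P) b x ^ p ∂w := by
  have hT := fun P : Set X =>
    (measurable_treeSum (hF.coe_subtree P).measurableSet q b).pow_const p
  have hP := fun (j : ℤ) (P : Set X) (hP : P ∈ maximalSets F ψ (2 ^ j)) =>
    hF.measurableSet_of_mem_maximalSets hP
  have hterm := fun (j : ℤ) P hPj =>
    ((hT P).const_mul (((2 : ℝ≥0∞) ^ (j + 1)) ^ p)).indicator (hP j P hPj)
  unfold principalMajorant
  rw [lintegral_tsum fun j => (Finset.measurable_fun_sum _ (hterm j)).aemeasurable]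
  refine tsum_congr fun j => (lintegral_finsetSum _ (hterm j)).trans ?_
  refine Finset.sum_congr rfl fun P hPj => ?_
  rw [lintegral_indicator (hP j P hPj), lintegral_const_mul _ (hT P)]

lemma measurable_principalMajorant (ψ b : Set X → ℝ≥0∞) (p q : ℝ) :
    Measurable (principalMajorant F ψ b p q) :=
  Measurable.tsum fun _ => Finset.measurable_fun_sum _ fun P hP =>
    (((measurable_treeSum (hF.coe_subtree P).measurableSet q b).pow_const p).const_mul _).indicator
      (hF.measurableSet_of_mem_maximalSets hP)

lemma lintegral_principalMajorant_le_levelSum (hA : DirectTest F lam σ w p q r A) (hr : 0 < r)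
    (hrp : r ≤ p) (ψ : Set X → ℝ≥0∞) :
    ∫⁻ x, principalMajorant F ψ (fun R => lam R * σ R) p q x ∂w ≤
      A * (2 ^ r * levelSum r σ (maximalFunction F ψ)) ^ (p / r) := by
  have hpr : 1 ≤ p / r := (one_le_div hr).2 hrp
  rw [hF.lintegral_principalMajorant]
  calc ∑' j : ℤ, ∑ P ∈ maximalSets F ψ (2 ^ j), ((2 : ℝ≥0∞) ^ (j + 1)) ^ p *
          ∫⁻ x in P, treeSum q (subtree F P) (fun R => lam R * σ R) x ^ p ∂w
      ≤ ∑' j : ℤ, ∑ P ∈ maximalSets F ψ (2 ^ j),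
          A * (((2 : ℝ≥0∞) ^ (j + 1)) ^ r * σ P) ^ (p / r) := by
        refine ENNReal.tsum_le_tsum fun j => Finset.sum_le_sum fun P hP => ?_
        rw [ENNReal.mul_rpow_of_nonneg _ _ (by linarith), ← ENNReal.rpow_mul _ r,
          mul_div_cancel₀ _ hr.ne', mul_left_comm]
        gcongr
        exact hA P (maximalSets_subset F ψ _ hP)
    _ ≤ ∑' j : ℤ, A *
          (((2 : ℝ≥0∞) ^ (j + 1)) ^ r * σ {x | 2 ^ j < maximalFunction F ψ x}) ^ (p / r) := by
        refine ENNReal.tsum_le_tsum fun j => ?_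
        rw [← Finset.mul_sum, ← hF.sum_measure_maximalSets]
        gcongr
        rw [Finset.mul_sum]
        exact sum_rpow_le_rpow_sum _ _ hpr
    _ ≤ A * (∑' j : ℤ, ((2 : ℝ≥0∞) ^ (j + 1)) ^ r *
          σ {x | 2 ^ j < maximalFunction F ψ x}) ^ (p / r) := by
        rw [ENNReal.tsum_mul_left]
        gcongr
        exact tsum_rpow_le_rpow_tsum _ hpr
    _ = A * (2 ^ r * levelSum r σ (maximalFunction F ψ)) ^ (p / r) := by
        simp_rw [levelSum, ← ENNReal.tsum_mul_left, two_zpow_add_one,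
          ENNReal.mul_rpow_of_nonneg _ _ hr.le, mul_assoc]

lemma lintegral_principalMajorant_mean_le (hσ : ∀ Q ∈ F, σ Q ≠ ∞)
    (hA : DirectTest F lam σ w p q r A) (hr : 1 < r) (hrp : r ≤ p) (hf : Measurable f) :
    ∫⁻ x, principalMajorant F (mean σ f) (fun R => lam R * σ R) p q x ∂w ≤
      A * (principalConst r * ∫⁻ x, f x ^ r ∂σ) ^ (p / r) := by
  have hr0 : 0 < r := by linarith
  have hpr : 0 ≤ p / r := div_nonneg (by linarith) hr0.le
  refine (hF.lintegral_principalMajorant_le_levelSum hA hr0 hrp _).trans ?_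
  rw [principalConst, mul_assoc, mul_assoc]
  gcongr
  refine (levelSum_le_lintegral_rpow (hF.measurable_maximalFunction _) hr0).trans ?_
  gcongr
  exact hF.lintegral_maximalFunction_mean_rpow_le hσ hf hr

end IsNestedFamily

end TwoWeight

section TwoWeightInequality

variable {X : Type*} [MeasurableSpace X] {F : Finset (Set X)} {b lam : Set X → ℝ≥0∞}
  {A B ε : ℝ≥0∞} {p q r : ℝ} {σ w : Measure X} {f : X → ℝ≥0∞}

lemma mul_rpow_one_div_rpow_conjExponent (hp : 1 < p) (hr : 1 < r) (H B W : ℝ≥0∞) :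
    (H ^ (1 / r) * (B * W ^ (r.conjExponent / p.conjExponent)) ^ (1 / r.conjExponent)) ^ p =
      B ^ (p / r.conjExponent) * H ^ (p / r) * W ^ (p - 1) := by
  have hp0 : 0 ≤ p := by linarith
  have hrc := (Real.HolderConjugate.conjExponent hr).symm
  have hexp : r.conjExponent / p.conjExponent * (p / r.conjExponent) = p - 1 := by
    rw [← (Real.HolderConjugate.conjExponent hp).div_conj_eq_sub_one]
    have := hrc.pos.ne'
    field_simp
  rw [ENNReal.mul_rpow_of_nonneg _ _ hp0, ← ENNReal.rpow_mul, ← ENNReal.rpow_mul,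
    one_div_mul_eq_div, one_div_mul_eq_div,
    ENNReal.mul_rpow_of_nonneg _ _ (div_nonneg hp0 hrc.nonneg), ← ENNReal.rpow_mul, hexp]
  ring

namespace IsNestedFamily

variable (hF : IsNestedFamily (F : Set (Set X)))
include hF

lemma rpow_ancestorSup_mul_setLIntegral_le {ψ : Set X → ℝ≥0∞} (hψ : ∀ Q ∈ F, ψ Q ≠ ∞) (hp : 1 < p)
    (hq : 0 ≤ q) {E Q : Set X} (hEQ : E ⊆ Q) :
    (2 * ancestorSup F ψ Q * ∫⁻ x in E, treeSum q (subtree F Q) b x ∂w) ^ p ≤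
      2 ^ p * (∫⁻ x in E, principalMajorant F ψ b p q x ∂w) * w E ^ (p - 1) := by
  have hp0 : 0 < p := by linarith
  have hT := measurable_treeSum (hF.coe_subtree Q).measurableSet q b
  rw [mul_assoc, ENNReal.mul_rpow_of_nonneg _ _ hp0.le, mul_assoc, ← lintegral_const_mul _ hT]
  gcongr
  refine (rpow_setLIntegral_le hp.le (hT.const_mul _).aemeasurable _).trans ?_
  gcongr ?_ * _
  exact setLIntegral_mono (hF.measurable_principalMajorant ψ b p q) fun x hx =>
    ancestorSup_mul_rpow_le_principalMajorant hψ hp0 hq (hEQ hx)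

lemma zpow_rpow_mul_measure_inter_layer_le (hσ : ∀ Q ∈ F, σ Q ≠ ∞) (hw : ∀ Q ∈ F, w Q ≠ ∞)
    (hlam : ∀ Q ∈ F, lam Q ≠ ∞) (hr : 1 < r) (hp : 1 < p) (hq : 1 < q)
    (hB : DualTest F lam σ w p q r B) (hf : Measurable f) (hfr : ∫⁻ x, f x ^ r ∂σ ≠ ∞)
    (hε : ε ≠ 0) (hε' : ε ≠ ∞) {k : ℤ} {Q : Set X}
    (hQ : Q ∈ maximalSets F (chainNorm q F (coeff lam σ f)) (2 ^ k)) :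
    ((2 : ℝ≥0∞) ^ k) ^ p * w (layer (treeSum q F (coeff lam σ f)) (k + 1) ∩ Q) ≤
      ε * (((2 : ℝ≥0∞) ^ k) ^ p * w Q) + 2 ^ (p - 1) * (ε⁻¹ ^ (p - 1) *
        (B ^ (p / r.conjExponent) * (∫⁻ x in Q, freshPart F (chainNorm q F (coeff lam σ f)) σ f
          (2 ^ k) (2 ^ (k + 2)) x ^ r ∂σ) ^ (p / r)) +
        2 ^ p * ∫⁻ x in layer (treeSum q F (coeff lam σ f)) (k + 1) ∩ Q,
          principalMajorant F (mean σ f) (fun R => lam R * σ R) p q x ∂w) := by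
  have hQF := maximalSets_subset F _ _ hQ
  have hlayer := measurableSet_layer (measurable_treeSum hF.measurableSet q (coeff lam σ f)) (k + 1)
  have hwE := ne_top_of_le_ne_top (hw Q hQF) (measure_mono
    (inter_subset_right (s := layer (treeSum q F (coeff lam σ f)) (k + 1))))
  refine rpow_mul_le_of_mul_le_add hp.le hwE hε hε'
    (hF.mul_measure_le hσ hr hq hB hf (fun R => coeff_ne_top hσ hlam hf.aemeasurable hr hfr) hQ
      (hlayer.inter (hF.measurableSet Q hQF)) inter_subset_right (fun x hx => ?_) (fun x hx => ?_))
    (mul_rpow_one_div_rpow_conjExponent hp hr _ _ _).le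
    (hF.rpow_ancestorSup_mul_setLIntegral_le
      (fun R hR => mean_ne_top (hσ R hR) hf.aemeasurable hr hfr) hp (by linarith)
      inter_subset_right)
  · rw [← two_zpow_add_one]
    exact hx.1.1
  · simpa only [add_assoc, one_add_one_eq_two] using hx.1.2

lemma tsum_sum_measure_maximalSets_le (φ : Set X → ℝ≥0∞) (hp : 0 < p) :
    ∑' k : ℤ, ∑ Q ∈ maximalSets F φ (2 ^ k), ((2 : ℝ≥0∞) ^ k) ^ p * w Q ≤
      geomConst p * ∫⁻ x, maximalFunction F φ x ^ p ∂w := by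
  simp_rw [← Finset.mul_sum, hF.sum_measure_maximalSets]
  exact levelSum_le_lintegral_rpow (hF.measurable_maximalFunction φ) hp

lemma tsum_sum_setLIntegral_layer_inter_le (φ : Set X → ℝ≥0∞) {g : X → ℝ≥0∞} (hg : Measurable g)
    (Θ : X → ℝ≥0∞) :
    ∑' k : ℤ, ∑ Q ∈ maximalSets F φ (2 ^ k), ∫⁻ x in layer g (k + 1) ∩ Q, Θ x ∂w ≤
      ∫⁻ x, Θ x ∂w := by
  calc ∑' k : ℤ, ∑ Q ∈ maximalSets F φ (2 ^ k), ∫⁻ x in layer g (k + 1) ∩ Q, Θ x ∂w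
      ≤ ∑' k : ℤ, ∫⁻ x in layer g (k + 1), Θ x ∂w := by
        refine ENNReal.tsum_le_tsum fun k => ?_
        rw [Finset.sum_congr rfl fun Q hQ => by
          rw [inter_comm, ← Measure.restrict_restrict (hF.measurableSet_of_mem_maximalSets hQ)],
          hF.sum_setLIntegral_maximalSets]
        exact setLIntegral_le_lintegral _ _
    _ = ∑' k : ℤ, ∫⁻ x in layer g k, Θ x ∂w :=
        (Equiv.addRight (1 : ℤ)).tsum_eq fun k => ∫⁻ x in layer g k, Θ x ∂w
    _ ≤ _ := tsum_setLIntegral_layer_le hg Θ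

lemma lintegral_maximalFunction_rpow_le_tsum_layer {φ : Set X → ℝ≥0∞} (hφ : ∀ Q ∈ F, φ Q ≠ ∞)
    (hp : 0 < p) :
    ∫⁻ x, maximalFunction F φ x ^ p ∂w ≤
      4 ^ p * ∑' k : ℤ, ∑ Q ∈ maximalSets F φ (2 ^ k),
        ((2 : ℝ≥0∞) ^ k) ^ p * w (layer (maximalFunction F φ) (k + 1) ∩ Q) := by
  have hM := hF.measurable_maximalFunction φ
  refine (lintegral_rpow_le_tsum_layer hM (fun x => maximalFunction_ne_top hφ) hp).trans ?_
  rw [← (Equiv.addRight (1 : ℤ)).tsum_eq, ← ENNReal.tsum_mul_left]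
  refine ENNReal.tsum_le_tsum fun k => ?_
  have hsub : layer (maximalFunction F φ) (k + 1) ⊆ {x | 2 ^ k < maximalFunction F φ x} :=
    fun x hx => (monotone_two_zpow (by lia)).trans_lt hx.1
  have hmeasure : w (layer (maximalFunction F φ) (k + 1)) =
      ∑ Q ∈ maximalSets F φ (2 ^ k), w (layer (maximalFunction F φ) (k + 1) ∩ Q) := by
    rw [Finset.sum_congr rfl fun Q hQ => by
        rw [inter_comm, ← Measure.restrict_apply (hF.measurableSet_of_mem_maximalSets hQ)],
      hF.sum_measure_maximalSets, Measure.restrict_apply (hF.measurableSet_lt_maximalFunction φ _),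
      inter_eq_right.2 hsub]
  rw [Equiv.coe_addRight, hmeasure, ← Finset.mul_sum, two_zpow_add_one, two_zpow_add_one,
    ← mul_assoc, ENNReal.mul_rpow_of_nonneg _ _ hp.le, mul_assoc]
  norm_num

lemma lintegral_treeSum_coeff_rpow_le_add (hσ : ∀ Q ∈ F, σ Q ≠ ∞) (hw : ∀ Q ∈ F, w Q ≠ ∞)
    (hlam : ∀ Q ∈ F, lam Q ≠ ∞) (hr : 1 < r) (hrp : r ≤ p) (hq : 1 < q)
    (hA : DirectTest F lam σ w p q r A) (hB : DualTest F lam σ w p q r B) (hf : Measurable f)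
    (hfr : ∫⁻ x, f x ^ r ∂σ ≠ ∞) (hε : ε ≠ 0) (hε' : ε ≠ ∞) :
    ∫⁻ x, treeSum q F (coeff lam σ f) x ^ p ∂w ≤
      4 ^ p * (ε * (geomConst p * ∫⁻ x, treeSum q F (coeff lam σ f) x ^ p ∂w) +
        2 ^ (p - 1) * (ε⁻¹ ^ (p - 1) *
          (B ^ (p / r.conjExponent) * (freshConst r * ∫⁻ x, f x ^ r ∂σ) ^ (p / r)) +
          2 ^ p * (A * (principalConst r * ∫⁻ x, f x ^ r ∂σ) ^ (p / r)))) := by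
  have hp : 1 < p := by linarith
  have hp0 : 0 < p := by linarith
  have hq0 : 0 < q := by linarith
  set c := coeff lam σ f
  have hc : ∀ R ∈ F, c R ≠ ∞ := fun R => coeff_ne_top hσ hlam hf.aemeasurable hr hfr
  have htree : treeSum q F c = maximalFunction F (chainNorm q F c) :=
    funext (hF.treeSum_eq_maximalFunction hq0 c)
  have hlocal := fun k Q hQ => hF.zpow_rpow_mul_measure_inter_layer_le (k := k) (Q := Q)
    hσ hw hlam hr hp hq hB hf hfr hε hε' hQ
  have hsplit := (hF.lintegral_maximalFunction_rpow_le_tsum_layer (w := w)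
    (fun Q _ => chainNorm_ne_top hq0.le hc) hp0).trans (mul_le_mul_right
      (ENNReal.tsum_le_tsum fun k => Finset.sum_le_sum (by rw [← htree]; exact hlocal k)) _)
  simp only [Finset.sum_add_distrib, ← Finset.mul_sum, ENNReal.tsum_add,
    ENNReal.tsum_mul_left] at hsplit
  rw [htree] at hsplit ⊢
  refine hsplit.trans ?_
  gcongr
  · simpa only [Finset.mul_sum] using hF.tsum_sum_measure_maximalSets_le _ hp0
  · exact hF.tsum_sum_setLIntegral_freshPart_rpow_le hσ hf hr hrp hfr
  · exact (hF.tsum_sum_setLIntegral_layer_inter_le _ (hF.measurable_maximalFunction _) _).trans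
      (hF.lintegral_principalMajorant_mean_le hσ hA hr hrp hf)

theorem lintegral_treeSum_coeff_rpow_le (hσ : ∀ Q ∈ F, σ Q ≠ ∞) (hw : ∀ Q ∈ F, w Q ≠ ∞)
    (hlam : ∀ Q ∈ F, lam Q ≠ ∞) (hr : 1 < r) (hrp : r ≤ p) (hq : 1 < q)
    (hA : DirectTest F lam σ w p q r A) (hB : DualTest F lam σ w p q r B) (hf : Measurable f)
    (hfr : ∫⁻ x, f x ^ r ∂σ ≠ ∞) :
    ∫⁻ x, treeSum q F (coeff lam σ f) x ^ p ∂w ≤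
      twoWeightConst p r * (B ^ (p / r.conjExponent) + A) * (∫⁻ x, f x ^ r ∂σ) ^ (p / r) := by
  have hp0 : 0 < p := by linarith
  have hpr : 0 ≤ p / r := div_nonneg hp0.le (by linarith)
  have hfinite : ∫⁻ x, treeSum q F (coeff lam σ f) x ^ p ∂w ≠ ∞ :=
    hF.lintegral_treeSum_rpow_ne_top hw (fun _ => coeff_ne_top hσ hlam hf.aemeasurable hr hfr)
      (zero_lt_one.trans hq) hp0
  have habsorb := hF.lintegral_treeSum_coeff_rpow_le_add hσ hw hlam hr hrp hq hA hB hf hfr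
    (absorbRatio_ne_zero hp0) (absorbRatio_ne_top p)
  rw [mul_add, absorbRatio_mul hp0] at habsorb
  refine (le_two_mul_of_le_half_add hfinite habsorb).trans ?_
  rw [twoWeightConst, ENNReal.mul_rpow_of_nonneg _ _ hpr, ENNReal.mul_rpow_of_nonneg _ _ hpr]
  set b := B ^ (p / r.conjExponent)
  set N := (∫⁻ x, f x ^ r ∂σ) ^ (p / r)
  set g := (absorbRatio p)⁻¹ ^ (p - 1) * freshConst r ^ (p / r)
  set m := 2 ^ p * principalConst r ^ (p / r)
  calc 2 * (4 ^ p * (2 ^ (p - 1) * ((absorbRatio p)⁻¹ ^ (p - 1) *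
        (b * (freshConst r ^ (p / r) * N)) + 2 ^ p * (A * (principalConst r ^ (p / r) * N)))))
      = 2 * (4 ^ p * (2 ^ (p - 1) * (g * b + m * A))) * N := by ring
    _ ≤ 2 * (4 ^ p * (2 ^ (p - 1) * ((g + m) * b + (g + m) * A))) * N := by
        gcongr
        · exact le_self_add
        · exact le_add_self
    _ = _ := by ring

end IsNestedFamily

end TwoWeightInequality

section Weights

variable {d : ℕ} {ω f : (Fin d → ℝ) → ℝ} {Q : Set (Fin d → ℝ)}

lemma IsWeight.aemeasurable (h : IsWeight ω) : AEMeasurable ω :=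
  h.locallyIntegrable.aestronglyMeasurable.aemeasurable

lemma IsWeight.enorm_ae_eq (h : IsWeight ω) : ∀ᵐ x, ‖ω x‖ₑ = ENNReal.ofReal (ω x) := by
  filter_upwards [h.pos] with x hx
  rw [Real.enorm_eq_ofReal hx.le]

lemma wMeasure_absolutelyContinuous (ω : (Fin d → ℝ) → ℝ) : wMeasure ω ≪ volume :=
  withDensity_absolutelyContinuous _ _

lemma IsWeight.setLIntegral_enorm_mul (h : IsWeight ω) (hQ : MeasurableSet Q)
    (hf : AEMeasurable f (wMeasure ω)) :
    ∫⁻ x in Q, ‖f x * ω x‖ₑ = ∫⁻ x in Q, ‖f x‖ₑ ∂(wMeasure ω) := by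
  have hr : (wMeasure ω).restrict Q =
      (volume.restrict Q).withDensity fun x => ENNReal.ofReal (ω x) :=
    restrict_withDensity hQ _
  rw [hr, lintegral_withDensity_eq_lintegral_mul₀' h.aemeasurable.ennreal_ofReal.restrict]
  · refine lintegral_congr_ae ?_
    filter_upwards [ae_restrict_of_ae h.enorm_ae_eq] with x hx
    rw [enorm_mul, hx, Pi.mul_apply, mul_comm]
  · rw [← hr]
    exact hf.enorm.restrict

lemma IsWeight.wMeasure_ne_top (h : IsWeight ω) (hQ : Bornology.IsBounded Q) :
    wMeasure ω Q ≠ ∞ := by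
  have hc : IsCompact (closure Q) := hQ.isCompact_closure
  refine ne_top_of_le_ne_top ?_ (measure_mono subset_closure)
  rw [wMeasure, withDensity_apply _ hc.measurableSet]
  refine ne_top_of_le_ne_top (h.locallyIntegrable.integrableOn_isCompact hc).2.ne ?_
  exact lintegral_mono fun x => Real.ofReal_le_enorm _

lemma IsWeight.wMeasure_ne_zero (h : IsWeight ω) (hQ : MeasurableSet Q) (hv : volume Q ≠ 0) :
    wMeasure ω Q ≠ 0 := by
  intro h0
  rw [wMeasure, withDensity_apply _ hQ,
    lintegral_eq_zero_iff' h.aemeasurable.ennreal_ofReal.restrict] at h0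
  have h1 : ∀ᵐ _ ∂(volume.restrict Q), False := by
    filter_upwards [h0, ae_restrict_of_ae h.pos] with x hx hx'
    simp only [Pi.zero_apply, ENNReal.ofReal_eq_zero] at hx
    linarith
  rw [Filter.eventually_false_iff_eq_bot, ae_eq_bot, Measure.restrict_eq_zero] at h1
  exact hv h1

lemma enorm_avg (hv : volume Q ≠ 0) (hv' : volume Q ≠ ∞) (g : (Fin d → ℝ) → ℝ) :
    ‖avg Q g‖ₑ = ‖∫ x in Q, g x‖ₑ / volume Q := by
  have hpos : 0 < volume.real Q := ENNReal.toReal_pos hv hv'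
  rw [avg, enorm_mul, enorm_inv hpos.ne', Real.enorm_eq_ofReal hpos.le, measureReal_def,
    ENNReal.ofReal_toReal hv', mul_comm, div_eq_mul_inv]

lemma IsWeight.enorm_avg_le (h : IsWeight ω) (hQ : MeasurableSet Q) (hv : volume Q ≠ 0)
    (hv' : volume Q ≠ ∞) (hf : AEMeasurable f (wMeasure ω)) :
    ‖avg Q fun x => f x * ω x‖ₑ ≤ (∫⁻ x in Q, ‖f x‖ₑ ∂(wMeasure ω)) / volume Q := by
  rw [enorm_avg hv hv', ← h.setLIntegral_enorm_mul hQ hf]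
  gcongr
  exact enorm_integral_le_lintegral_enorm _

lemma IsWeight.aemeasurable_mul (h : IsWeight ω) (hf : AEMeasurable f (wMeasure ω)) :
    AEMeasurable (fun x => f x * ω x) := by
  obtain ⟨g, hg, hfg⟩ := hf
  refine (hg.aemeasurable.mul h.aemeasurable).congr ?_
  have h1 := (ae_withDensity_iff' h.aemeasurable.ennreal_ofReal).1 hfg
  filter_upwards [h1, h.pos] with x hx hpos
  rw [Pi.mul_apply, hx (by simpa using hpos)]

lemma IsWeight.enorm_avg_eq (h : IsWeight ω) (hQ : MeasurableSet Q) (hv : volume Q ≠ 0)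
    (hv' : volume Q ≠ ∞) (hf : AEMeasurable f (wMeasure ω)) (hf0 : ∀ x, 0 ≤ f x)
    (hfi : ∫⁻ x in Q, ‖f x‖ₑ ∂(wMeasure ω) ≠ ∞) :
    ‖avg Q fun x => f x * ω x‖ₑ = (∫⁻ x in Q, ‖f x‖ₑ ∂(wMeasure ω)) / volume Q := by
  rw [enorm_avg hv hv', ← h.setLIntegral_enorm_mul hQ hf]
  rw [← h.setLIntegral_enorm_mul hQ hf] at hfi
  congr 1
  have hnn : ∀ᵐ x ∂(volume.restrict Q), 0 ≤ f x * ω x := by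
    filter_upwards [ae_restrict_of_ae h.pos] with x hx
    exact mul_nonneg (hf0 x) hx.le
  have hi : Integrable (fun x => f x * ω x) (volume.restrict Q) :=
    ⟨(h.aemeasurable_mul hf).restrict.aestronglyMeasurable, hfi.lt_top⟩
  rw [Real.enorm_eq_ofReal (integral_nonneg_of_ae hnn),
    ofReal_integral_eq_lintegral_ofReal hi hnn]
  refine lintegral_congr_ae ?_
  filter_upwards [hnn] with x hx
  rw [Real.enorm_eq_ofReal hx]

lemma IsWeight.avg_nonneg (h : IsWeight ω) (Q : Set (Fin d → ℝ)) (hf0 : ∀ x, 0 ≤ f x) :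
    0 ≤ avg Q fun x => f x * ω x := by
  refine mul_nonneg (by positivity) (integral_nonneg_of_ae ?_)
  filter_upwards [ae_restrict_of_ae h.pos] with x hx
  exact mul_nonneg (hf0 x) hx.le

end Weights

section Grids

variable {d : ℕ} {D : Set (Set (Fin d → ℝ))} {Q R : Set (Fin d → ℝ)} {l : ℝ}

lemma IsCube.exists_eq_pi (h : IsCube l Q) :
    ∃ a : Fin d → ℝ, Q = univ.pi fun i => Ico (a i) (a i + l) := by
  obtain ⟨a, rfl⟩ := h
  refine ⟨a, ?_⟩
  ext x
  simp

lemma IsCube.measurableSet (h : IsCube l Q) : MeasurableSet Q := by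
  obtain ⟨a, rfl⟩ := h.exists_eq_pi
  exact MeasurableSet.univ_pi fun i => measurableSet_Ico

lemma IsCube.nonempty_interior (h : IsCube l Q) (hl : 0 < l) : (interior Q).Nonempty := by
  obtain ⟨a, rfl⟩ := h.exists_eq_pi
  rw [interior_pi_set finite_univ, univ_pi_nonempty_iff]
  intro i
  rw [interior_Ico, nonempty_Ioo]
  linarith

lemma IsCube.isBounded (h : IsCube l Q) : Bornology.IsBounded Q := by
  obtain ⟨a, rfl⟩ := h.exists_eq_pi
  exact Bornology.IsBounded.pi fun i => Metric.isBounded_Ico _ _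

lemma IsCube.eq_of_subset (hQ : IsCube l Q) (hR : IsCube l R) (hl : 0 < l) (h : Q ⊆ R) :
    Q = R := by
  obtain ⟨a, rfl⟩ := hQ.exists_eq_pi
  obtain ⟨b, rfl⟩ := hR.exists_eq_pi
  have hne : (univ.pi fun i => Ico (a i) (a i + l)).Nonempty :=
    univ_pi_nonempty_iff.2 fun i => nonempty_Ico.2 (by linarith)
  have h1 : ∀ i, Ico (a i) (a i + l) ⊆ Ico (b i) (b i + l) := by
    rcases pi_subset_pi_iff.1 h with h1 | h1
    · exact fun i => h1 i (mem_univ i)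
    · exact absurd h1 hne.ne_empty
  congr 1
  ext1 i
  have h2 := (Ico_subset_Ico_iff (by linarith)).1 (h1 i)
  have : a i = b i := by linarith [h2.1, h2.2]
  rw [this]

lemma IsDyadicGrid.countable (hD : IsDyadicGrid D) : D.Countable := by
  have hsub : D ⊆ ⋃ k : ℤ, {Q ∈ D | IsCube ((2 : ℝ) ^ k) Q} := fun Q hQ => by
    obtain ⟨k, hk⟩ := hD.isCube Q hQ
    exact mem_iUnion.2 ⟨k, hQ, hk⟩
  refine (countable_iUnion fun k => ?_).mono hsub
  have hpos : (0 : ℝ) < 2 ^ k := by positivity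
  refine PairwiseDisjoint.countable_of_nonempty_interior (s := id) (fun Q hQ R hR hne => ?_)
    fun Q hQ => hQ.2.nonempty_interior hpos
  rcases hD.nested Q hQ.1 R hR.1 with h | h | h
  · exact absurd (hQ.2.eq_of_subset hR.2 hpos h) hne
  · exact absurd (hR.2.eq_of_subset hQ.2 hpos h).symm hne
  · exact h

/-- A countable nested family of bounded measurable sets of positive volume. These are the only
properties of a dyadic grid on which the boundedness of the operators depends. -/
structure IsNestedGrid (D : Set (Set (Fin d → ℝ))) : Prop extends IsNestedFamily D where
  countable : D.Countable
  isBounded : ∀ Q ∈ D, Bornology.IsBounded Q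
  volume_ne_zero : ∀ Q ∈ D, volume Q ≠ 0

lemma IsDyadicGrid.isNestedGrid (hD : IsDyadicGrid D) : IsNestedGrid D where
  measurableSet Q hQ := (hD.isCube Q hQ).choose_spec.measurableSet
  nested := hD.nested
  countable := hD.countable
  isBounded Q hQ := (hD.isCube Q hQ).choose_spec.isBounded
  volume_ne_zero Q hQ := (Measure.measure_pos_of_nonempty_interior _
    ((hD.isCube Q hQ).choose_spec.nonempty_interior (by positivity))).ne'

namespace IsNestedGrid

variable (hD : IsNestedGrid D)
include hD

lemma mono {𝒬 : Set (Set (Fin d → ℝ))} (h : 𝒬 ⊆ D) : IsNestedGrid 𝒬 where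
  __ := hD.toIsNestedFamily.mono h
  countable := hD.countable.mono h
  isBounded Q hQ := hD.isBounded Q (h hQ)
  volume_ne_zero Q hQ := hD.volume_ne_zero Q (h hQ)

lemma volume_ne_top (hQ : Q ∈ D) : volume Q ≠ ∞ := (hD.isBounded Q hQ).measure_lt_top.ne

lemma wMeasure_ne_zero {ω : (Fin d → ℝ) → ℝ} (hω : IsWeight ω) (hQ : Q ∈ D) :
    wMeasure ω Q ≠ 0 :=
  hω.wMeasure_ne_zero (hD.measurableSet Q hQ) (hD.volume_ne_zero Q hQ)

lemma wMeasure_ne_top {ω : (Fin d → ℝ) → ℝ} (hω : IsWeight ω) (hQ : Q ∈ D) :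
    wMeasure ω Q ≠ ∞ :=
  hω.wMeasure_ne_top (hD.isBounded Q hQ)

end IsNestedGrid

end Grids

section SubtypeSums

variable {ι : Type*} {S : Set ι}

lemma sum_le_tsum_coe (g : ι → ℝ≥0∞) {F : Finset ι} (hF : (F : Set ι) ⊆ S) :
    ∑ i ∈ F, g i ≤ ∑' i : S, g i :=
  (Finset.tsum_subtype' F g).symm.trans_le (ENNReal.tsum_mono_subtype g hF)

open Classical in
lemma tsum_coe_ite (g : ι → ℝ≥0∞) {F : Finset ι} (hF : (F : Set ι) ⊆ S) :
    ∑' i : S, (if (i : ι) ∈ F then g i else 0) = ∑ i ∈ F, g i := by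
  rw [tsum_subtype S fun i => if i ∈ F then g i else 0, tsum_eq_sum (s := F)]
  · exact Finset.sum_congr rfl fun i hi => by simp [hi, hF (Finset.mem_coe.2 hi)]
  · exact fun i hi => by simp [hi]

lemma lintegral_tsum_coe_rpow_le {X : Type*} [MeasurableSpace X] {μ : Measure X}
    {g : ι → X → ℝ≥0∞} (hS : S.Countable) (hg : ∀ i ∈ S, Measurable (g i)) {s : ℝ} (hs : 0 < s)
    {M : ℝ≥0∞} (h : ∀ F : Finset ι, (F : Set ι) ⊆ S → ∫⁻ x, (∑ i ∈ F, g i x) ^ s ∂μ ≤ M) :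
    ∫⁻ x, (∑' i : S, g i x) ^ s ∂μ ≤ M := by
  classical
  have := hS.to_subtype
  have hsup : ∀ x, (∑' i : S, g i x) ^ s = ⨆ F : Finset S, (∑ i ∈ F, g i x) ^ s := fun x => by
    rw [ENNReal.tsum_eq_iSup_sum]
    exact (ENNReal.orderIsoRpow s hs).map_iSup _
  simp_rw [hsup]
  rw [lintegral_iSup_directed fun F : Finset S =>
    ((Finset.measurable_fun_sum F fun i _ => hg i i.2).pow_const s).aemeasurable]
  · refine iSup_le fun F => ?_
    simpa using h (F.map (Function.Embedding.subtype _)) (by simp)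
  · exact Monotone.directed_le fun F G hFG x =>
      ENNReal.rpow_le_rpow (Finset.sum_le_sum_of_subset hFG) hs.le

end SubtypeSums

section Operators

variable {d : ℕ} {𝒬 : Set (Set (Fin d → ℝ))} {τ : 𝒬 → ℝ≥0} {σ w f g : (Fin d → ℝ) → ℝ}
  {q : ℝ} {Q : Set (Fin d → ℝ)} {x : Fin d → ℝ} {a : 𝒬 → (Fin d → ℝ) → ℝ}

/-- The coefficients `τ_R / |R|`, for which `coeff (avgCoeff τ) (wMeasure σ) f R = τ_R 𝔼_R(fσ)` when
`R ∈ 𝒬`, extended by zero to all sets. -/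
noncomputable def avgCoeff (τ : 𝒬 → ℝ≥0) : Set (Fin d → ℝ) → ℝ≥0∞ :=
  Function.extend Subtype.val (fun R : 𝒬 => τ R / volume (R : Set (Fin d → ℝ))) 0

lemma avgCoeff_coe (τ : 𝒬 → ℝ≥0) (R : 𝒬) :
    avgCoeff τ R = τ R / volume (R : Set (Fin d → ℝ)) :=
  Subtype.val_injective.extend_apply _ _ _

lemma IsNestedGrid.avgCoeff_ne_top (h : IsNestedGrid 𝒬) (τ : 𝒬 → ℝ≥0) (hQ : Q ∈ 𝒬) :
    avgCoeff τ Q ≠ ∞ := by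
  rw [avgCoeff_coe τ ⟨Q, hQ⟩]
  exact ENNReal.div_ne_top (by simp) (h.volume_ne_zero Q hQ)

lemma IsNestedGrid.enorm_mul_avg_le (h : IsNestedGrid 𝒬) (τ : 𝒬 → ℝ≥0) (hσ : IsWeight σ)
    (hf : AEMeasurable f (wMeasure σ)) (R : 𝒬) :
    ‖(τ R : ℝ) * avg (R : Set (Fin d → ℝ)) fun y => f y * σ y‖ₑ ≤
      coeff (avgCoeff τ) (wMeasure σ) (‖f ·‖ₑ) R := by
  rw [coeff, enorm_mul, avgCoeff_coe, ENNReal.mul_comm_div, NNReal.enorm_eq]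
  gcongr
  exact hσ.enorm_avg_le (h.measurableSet R R.2) (h.volume_ne_zero R R.2) (h.volume_ne_top R.2) hf

lemma IsNestedGrid.enorm_mul_avg_eq (h : IsNestedGrid 𝒬) (τ : 𝒬 → ℝ≥0) (hσ : IsWeight σ)
    (hf : AEMeasurable f (wMeasure σ)) (hf0 : ∀ y, 0 ≤ f y) (R : 𝒬)
    (hfi : ∫⁻ y in R, ‖f y‖ₑ ∂(wMeasure σ) ≠ ∞) :
    ‖(τ R : ℝ) * avg (R : Set (Fin d → ℝ)) fun y => f y * σ y‖ₑ =
      coeff (avgCoeff τ) (wMeasure σ) (‖f ·‖ₑ) R := by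
  rw [coeff, enorm_mul, avgCoeff_coe, ENNReal.mul_comm_div, NNReal.enorm_eq,
    hσ.enorm_avg_eq (h.measurableSet R R.2) (h.volume_ne_zero R R.2) (h.volume_ne_top R.2) hf hf0
      hfi]

lemma Tbar_eq (hq : 0 < q) : Tbar q τ σ f x = (∑' R : 𝒬, (R : Set (Fin d → ℝ)).indicator
    (fun _ => ‖(τ R : ℝ) * avg (R : Set (Fin d → ℝ)) fun y => f y * σ y‖ₑ ^ q) x) ^ (1 / q) := by
  rw [Tbar]
  congr 2 with R
  by_cases hx : x ∈ (R : Set (Fin d → ℝ)) <;> simp [hx, hq]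

lemma IsNestedGrid.Tbar_le (h : IsNestedGrid 𝒬) (hσ : IsWeight σ)
    (hf : AEMeasurable f (wMeasure σ)) (hq : 0 < q) :
    Tbar q τ σ f x ≤ (∑' R : 𝒬, (R : Set (Fin d → ℝ)).indicator
      (fun _ => coeff (avgCoeff τ) (wMeasure σ) (‖f ·‖ₑ) R ^ q) x) ^ (1 / q) := by
  rw [Tbar_eq hq]
  gcongr with R
  exact h.enorm_mul_avg_le τ hσ hf R

lemma IsNestedGrid.treeSum_le_Tbar (h : IsNestedGrid 𝒬) (hσ : IsWeight σ)
    (hf : AEMeasurable f (wMeasure σ)) (hf0 : ∀ y, 0 ≤ f y)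
    (hfi : ∀ R ∈ 𝒬, ∫⁻ y in R, ‖f y‖ₑ ∂(wMeasure σ) ≠ ∞) (hq : 0 < q)
    {F : Finset (Set (Fin d → ℝ))} (hF : (F : Set (Set (Fin d → ℝ))) ⊆ 𝒬) :
    treeSum q F (coeff (avgCoeff τ) (wMeasure σ) (‖f ·‖ₑ)) x ≤ Tbar q τ σ f x := by
  rw [Tbar_eq hq, treeSum]
  simp_rw [h.enorm_mul_avg_eq τ hσ hf hf0 _ (hfi _ (Subtype.coe_prop _))]
  gcongr
  exact sum_le_tsum_coe
    (fun R => R.indicator (fun _ => coeff (avgCoeff τ) (wMeasure σ) (‖f ·‖ₑ) R ^ q) x) hF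

/-- The majorant of `|U({1_{Q ∩ R} a_R w})|` obtained by taking absolute values inside the series
and inside the averages. -/
noncomputable def dualMajorant (τ : 𝒬 → ℝ≥0) (w : (Fin d → ℝ) → ℝ) (Q : Set (Fin d → ℝ))
    (a : 𝒬 → (Fin d → ℝ) → ℝ) (x : Fin d → ℝ) : ℝ≥0∞ :=
  ∑' R : 𝒬, (R : Set (Fin d → ℝ)).indicator
    (fun _ => avgCoeff τ R * ∫⁻ y in Q ∩ R, ‖a R y‖ₑ ∂(wMeasure w)) x

lemma coeff_enorm_indicator {X : Type*} [MeasurableSpace X] {μ : Measure X} {Q R : Set X}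
    (lam : Set X → ℝ≥0∞) (hQ : MeasurableSet Q) (hR : MeasurableSet R) (g : X → ℝ) :
    coeff lam μ (‖(Q ∩ R).indicator g ·‖ₑ) R = lam R * ∫⁻ y in Q ∩ R, ‖g y‖ₑ ∂μ := by
  simp_rw [coeff, enorm_indicator_eq_indicator_enorm]
  rw [setLIntegral_indicator (hQ.inter hR), inter_assoc, inter_self]

lemma indicator_fun_mul_left {X : Type*} (S : Set X) (g w : X → ℝ) :
    (S.indicator fun y => g y * w y) = fun y => S.indicator g y * w y :=
  funext fun _ => indicator_mul_left _ _ _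

lemma enorm_indicator_avg_mul (τ : 𝒬 → ℝ≥0) (R : 𝒬) (S : Set (Fin d → ℝ))
    (g w : (Fin d → ℝ) → ℝ) (x : Fin d → ℝ) :
    ‖(R : Set (Fin d → ℝ)).indicator (fun _ => avg (R : Set (Fin d → ℝ))
        (S.indicator fun y => g y * w y) * (τ R : ℝ)) x‖ₑ =
      (R : Set (Fin d → ℝ)).indicator (fun _ => ‖(τ R : ℝ) * avg (R : Set (Fin d → ℝ))
        fun y => S.indicator g y * w y‖ₑ) x := by
  simp_rw [enorm_indicator_eq_indicator_enorm, indicator_fun_mul_left, mul_comm (avg _ _)]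

lemma IsNestedGrid.absU_le_dualMajorant (h : IsNestedGrid 𝒬) (hw : IsWeight w)
    (hQ : MeasurableSet Q) (ha : ∀ R, AEMeasurable (a R) volume) :
    absU τ (fun R => (Q ∩ (R : Set (Fin d → ℝ))).indicator fun y => a R y * w y) x ≤
      dualMajorant τ w Q a x := by
  have hle : ∑' R : 𝒬, ‖(R : Set (Fin d → ℝ)).indicator (fun _ => avg (R : Set (Fin d → ℝ))
      ((Q ∩ (R : Set (Fin d → ℝ))).indicator fun y => a R y * w y) * (τ R : ℝ)) x‖ₑ ≤
        dualMajorant τ w Q a x := by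
    refine ENNReal.tsum_le_tsum fun R => ?_
    have hR := h.measurableSet R R.2
    rw [enorm_indicator_avg_mul, ← coeff_enorm_indicator _ hQ hR]
    exact indicator_le_indicator (h.enorm_mul_avg_le τ hw
      (((ha R).mono_ac (wMeasure_absolutelyContinuous w)).indicator (hQ.inter hR)) R)
  rcases eq_or_ne (dualMajorant τ w Q a x) ∞ with htop | htop
  · rw [htop]
    exact le_top
  · rw [absU, if_pos (Summable.of_enorm (ne_top_of_le_ne_top htop hle))]
    exact enorm_tsum_le_tsum_enorm.trans hle

lemma IsNestedGrid.dualMajorant_le_absU (h : IsNestedGrid 𝒬) (hw : IsWeight w)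
    (hQ : MeasurableSet Q) (ha : ∀ R, AEMeasurable (a R) volume) (ha0 : ∀ R y, 0 ≤ a R y)
    (hfi : ∀ R : 𝒬, ∫⁻ y in R, ‖(Q ∩ (R : Set (Fin d → ℝ))).indicator (a R) y‖ₑ ∂(wMeasure w) ≠ ∞) :
    dualMajorant τ w Q a x ≤
      absU τ (fun R => (Q ∩ (R : Set (Fin d → ℝ))).indicator fun y => a R y * w y) x := by
  rw [absU]
  split_ifs with hs
  swap
  · exact le_top
  have ha0' : ∀ (R : 𝒬) y, 0 ≤ (Q ∩ (R : Set (Fin d → ℝ))).indicator (a R) y := fun R =>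
    indicator_nonneg fun y _ => ha0 R y
  have hnn : ∀ R : 𝒬, 0 ≤ (R : Set (Fin d → ℝ)).indicator (fun _ => avg (R : Set (Fin d → ℝ))
      ((Q ∩ (R : Set (Fin d → ℝ))).indicator fun y => a R y * w y) * (τ R : ℝ)) x := fun R => by
    refine indicator_nonneg (fun _ _ => mul_nonneg ?_ (by positivity)) x
    rw [indicator_fun_mul_left]
    exact hw.avg_nonneg _ (ha0' R)
  rw [Real.enorm_eq_ofReal (tsum_nonneg hnn), ENNReal.ofReal_tsum_of_nonneg hnn hs]
  refine ENNReal.tsum_le_tsum fun R => ?_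
  have hR := h.measurableSet R R.2
  rw [← Real.enorm_eq_ofReal (hnn R), enorm_indicator_avg_mul, ← coeff_enorm_indicator _ hQ hR,
    h.enorm_mul_avg_eq τ hw (((ha R).mono_ac (wMeasure_absolutelyContinuous w)).indicator
      (hQ.inter hR)) (ha0' R) R (hfi R)]

end Operators

section FiniteSubfamilies

variable {X Y ε ε' : Type*} [MeasurableSpace X] [MeasurableSpace Y] [TopologicalSpace ε]
  [ContinuousENorm ε] [TopologicalSpace ε'] [ContinuousENorm ε']

lemma eLpNorm_ofReal_le_mul_iff {μ : Measure X} {ν : Measure Y} {f : X → ε} {g : Y → ε'}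
    {p r : ℝ} (hp : 0 < p) (hr : 0 < r) (C : ℝ≥0∞) :
    eLpNorm g (ENNReal.ofReal p) ν ≤ C * eLpNorm f (ENNReal.ofReal r) μ ↔
      ∫⁻ y, ‖g y‖ₑ ^ p ∂ν ≤ C ^ p * (∫⁻ x, ‖f x‖ₑ ^ r ∂μ) ^ (p / r) := by
  rw [eLpNorm_eq_lintegral_rpow_enorm_toReal (by simpa using hp) (by simp),
    eLpNorm_eq_lintegral_rpow_enorm_toReal (by simpa using hr) (by simp),
    ENNReal.toReal_ofReal hp.le, ENNReal.toReal_ofReal hr.le, ← ENNReal.rpow_le_rpow_iff hp,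
    rpow_one_div_rpow hp.ne', ENNReal.mul_rpow_of_nonneg _ _ hp.le, ← ENNReal.rpow_mul,
    one_div_mul_eq_div]

variable {d : ℕ} {𝒬 : Set (Set (Fin d → ℝ))} {τ : 𝒬 → ℝ≥0} {σ w f : (Fin d → ℝ) → ℝ}
  {p q r : ℝ} {C : ℝ≥0∞}

lemma BoundedBy.lintegral_treeSum_rpow_le (hC : BoundedBy r p q τ σ w C) (h : IsNestedGrid 𝒬)
    (hσ : IsWeight σ) (hr : 1 < r) (hp : 0 < p) (hq : 0 < q)
    {F : Finset (Set (Fin d → ℝ))} (hF : (F : Set (Set (Fin d → ℝ))) ⊆ 𝒬)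
    {f : (Fin d → ℝ) → ℝ≥0∞} (hf : Measurable f) (hfr : ∫⁻ x, f x ^ r ∂(wMeasure σ) ≠ ∞) :
    ∫⁻ x, treeSum q F (coeff (avgCoeff τ) (wMeasure σ) f) x ^ p ∂(wMeasure w) ≤
      C ^ p * (∫⁻ x, f x ^ r ∂(wMeasure σ)) ^ (p / r) := by
  have hr0 : 0 < r := by linarith
  have hfin : ∀ᵐ x ∂(wMeasure σ), ‖(f x).toReal‖ₑ = f x := by
    filter_upwards [ae_lt_top (hf.pow_const r) hfr] with x hx
    exact Real.enorm_toReal fun htop => by simp [htop, hr0] at hx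
  have hnorm : ∫⁻ x, ‖(f x).toReal‖ₑ ^ r ∂(wMeasure σ) = ∫⁻ x, f x ^ r ∂(wMeasure σ) :=
    lintegral_congr_ae (hfin.mono fun x hx => by simp only [hx])
  have hset : ∀ R, ∫⁻ x in R, ‖(f x).toReal‖ₑ ∂(wMeasure σ) = ∫⁻ x in R, f x ∂(wMeasure σ) :=
    fun R => lintegral_congr_ae (ae_restrict_of_ae hfin)
  have hmem : MemLp (fun x => (f x).toReal) (ENNReal.ofReal r) (wMeasure σ) := by
    refine ⟨hf.ennreal_toReal.aestronglyMeasurable, ?_⟩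
    rw [eLpNorm_lt_top_iff_lintegral_rpow_enorm_lt_top (by simpa using hr0) (by simp),
      ENNReal.toReal_ofReal hr0.le, hnorm]
    exact hfr.lt_top
  have hT := (eLpNorm_ofReal_le_mul_iff hp hr0 C).1 (hC _ hmem)
  rw [hnorm] at hT
  refine (lintegral_mono fun x => ?_).trans hT
  have hcoeff : coeff (avgCoeff τ) (wMeasure σ) f =
      coeff (avgCoeff τ) (wMeasure σ) (fun x => ‖(f x).toReal‖ₑ) := by
    ext R
    rw [coeff, coeff, hset]
  rw [hcoeff]
  gcongr
  refine h.treeSum_le_Tbar hσ hf.ennreal_toReal.aemeasurable (fun _ => ENNReal.toReal_nonneg)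
    (fun R hR => ?_) hq hF
  rw [hset]
  exact setLIntegral_ne_top_of_rpow (h.wMeasure_ne_top hσ hR) hf.aemeasurable hr hfr

lemma IsNestedGrid.boundedBy_of_lintegral_treeSum_rpow_le (h : IsNestedGrid 𝒬) (hσ : IsWeight σ)
    (hr : 0 < r) (hp : 0 < p) (hq : 0 < q)
    (hC : ∀ F : Finset (Set (Fin d → ℝ)), (F : Set (Set (Fin d → ℝ))) ⊆ 𝒬 →
      ∀ f : (Fin d → ℝ) → ℝ≥0∞, Measurable f → ∫⁻ x, f x ^ r ∂(wMeasure σ) ≠ ∞ →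
      ∫⁻ x, treeSum q F (coeff (avgCoeff τ) (wMeasure σ) f) x ^ p ∂(wMeasure w) ≤
        C ^ p * (∫⁻ x, f x ^ r ∂(wMeasure σ)) ^ (p / r)) :
    BoundedBy r p q τ σ w C := by
  intro f hf
  obtain ⟨g, hgm, hfg⟩ := hf.aestronglyMeasurable.aemeasurable.enorm
  have hnorm : ∫⁻ x, ‖f x‖ₑ ^ r ∂(wMeasure σ) = ∫⁻ x, g x ^ r ∂(wMeasure σ) :=
    lintegral_congr_ae (hfg.mono fun x hx => by simp only [hx])
  have hcoeff : coeff (avgCoeff τ) (wMeasure σ) (‖f ·‖ₑ) = coeff (avgCoeff τ) (wMeasure σ) g := by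
    ext R
    rw [coeff, coeff, lintegral_congr_ae (ae_restrict_of_ae hfg)]
  have hgr : ∫⁻ x, g x ^ r ∂(wMeasure σ) ≠ ∞ := by
    have hfin := (eLpNorm_lt_top_iff_lintegral_rpow_enorm_lt_top (by simpa using hr) (by simp)).1
      hf.eLpNorm_lt_top
    rw [ENNReal.toReal_ofReal hr.le, hnorm] at hfin
    exact hfin.ne
  rw [eLpNorm_ofReal_le_mul_iff hp hr, hnorm]
  calc ∫⁻ x, ‖Tbar q τ σ f x‖ₑ ^ p ∂(wMeasure w)
      ≤ ∫⁻ x, (∑' R : 𝒬, (R : Set (Fin d → ℝ)).indicator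
          (fun _ => coeff (avgCoeff τ) (wMeasure σ) g R ^ q) x) ^ (p / q) ∂(wMeasure w) := by
        refine lintegral_mono fun x => ?_
        rw [← one_div_mul_eq_div, ENNReal.rpow_mul, ← hcoeff]
        exact ENNReal.rpow_le_rpow
          (h.Tbar_le hσ hf.aestronglyMeasurable.aemeasurable hq) hp.le
    _ ≤ C ^ p * (∫⁻ x, g x ^ r ∂(wMeasure σ)) ^ (p / r) := by
        refine lintegral_tsum_coe_rpow_le
          (g := fun R => R.indicator fun _ => coeff (avgCoeff τ) (wMeasure σ) g R ^ q) h.countable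
          (fun R hR => measurable_const.indicator (h.measurableSet R hR)) (div_pos hp hq)
          fun F hF => ?_
        simpa only [treeSum, ← ENNReal.rpow_mul, one_div_mul_eq_div] using hC F hF g hgm hgr

end FiniteSubfamilies

section Duality

variable {X : Type*} [MeasurableSpace X] {F : Finset (Set X)} {lam : Set X → ℝ≥0∞}
  {σ ν : Measure X} {a : Set X → X → ℝ≥0∞} {p q r : ℝ} {R : Set X} {C : ℝ≥0∞}

lemma IsSubunitSeq.le_one (ha : IsSubunitSeq q F a) (hq : 1 < q) (hR : R ∈ F) (x : X) :
    a R x ≤ 1 := by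
  rw [← ENNReal.rpow_le_rpow_iff (Real.HolderConjugate.conjExponent hq).symm.pos,
    ENNReal.one_rpow]
  exact (Finset.single_le_sum (f := fun R => a R x ^ q.conjExponent) (fun _ _ => zero_le) hR).trans
    (ha.sum_rpow_le_one x)

lemma IsSubunitSeq.lintegral_le (ha : IsSubunitSeq q F a) (hq : 1 < q) (hR : R ∈ F) :
    ∫⁻ x, a R x ∂ν ≤ ν univ :=
  (lintegral_mono fun x => ha.le_one hq hR x).trans_eq lintegral_one

lemma dualSum_eq_treeSum (F : Finset (Set X)) (lam : Set X → ℝ≥0∞) (ν : Measure X)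
    (a : Set X → X → ℝ≥0∞) :
    dualSum F lam ν a = treeSum 1 F fun R => lam R * ∫⁻ y, a R y ∂ν := by
  ext x
  simp only [treeSum, dualSum, div_one, ENNReal.rpow_one]

lemma IsNestedFamily.lintegral_dualSum_rpow_le (hF : IsNestedFamily (F : Set (Set X)))
    (hσ : ∀ R ∈ F, σ R ≠ ∞) (hν : ν univ ≠ ∞) (hlam : ∀ R ∈ F, lam R ≠ ∞) (hr : 1 < r) (hp : 1 < p)
    (hq : 1 < q)
    (hC : ∀ f : X → ℝ≥0∞, Measurable f → ∫⁻ x, f x ^ r ∂σ ≠ ∞ →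
      ∫⁻ x, treeSum q F (coeff lam σ f) x ^ p ∂ν ≤ C ^ p * (∫⁻ x, f x ^ r ∂σ) ^ (p / r))
    (ha : IsSubunitSeq q F a) :
    ∫⁻ x, dualSum F lam ν a x ^ r.conjExponent ∂σ ≤
      C ^ r.conjExponent * ν univ ^ (r.conjExponent / p.conjExponent) := by
  have hrc := (Real.HolderConjugate.conjExponent hr).symm
  have hpc := Real.HolderConjugate.conjExponent hp
  set J := ∫⁻ x, dualSum F lam ν a x ^ r.conjExponent ∂σ with hJ
  have hJtop : J ≠ ∞ := by
    simp only [hJ, dualSum_eq_treeSum]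
    exact hF.lintegral_treeSum_rpow_ne_top hσ (fun R hR => ENNReal.mul_ne_top (hlam R hR)
      (ne_top_of_le_ne_top hν (ha.lintegral_le hq hR))) one_pos hrc.pos
  -- The extremal function in the duality between `L^r` and `L^{r'}`.
  set f : X → ℝ≥0∞ := fun x => dualSum F lam ν a x ^ (r.conjExponent - 1) with hf
  have hfm : Measurable f := (measurable_dualSum hF.measurableSet lam ν a).pow_const _
  have hfr : ∫⁻ x, f x ^ r ∂σ = J := by
    simp only [hf, ← ENNReal.rpow_mul, hrc.sub_one_mul_conj, hJ]
  have hpair : J ≤ ∫⁻ x, treeSum q F (coeff lam σ f) x ∂ν := by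
    refine le_of_eq_of_le ?_ (ha.sum_mul_lintegral_le hq (coeff lam σ f))
    rw [sum_coeff_mul_lintegral hF.measurableSet (fun _ _ => subset_univ _) lam hfm a,
      setLIntegral_univ]
    simp only [hf, rpow_sub_one_mul_self hrc.lt.le, hJ]
  have hself : J ≤ C * ν univ ^ (1 / p.conjExponent) * J ^ (1 / r) := by
    rw [← ENNReal.rpow_le_rpow_iff hpc.pos]
    calc J ^ p ≤ (∫⁻ x, treeSum q F (coeff lam σ f) x ∂ν) ^ p := by gcongr
      _ ≤ (∫⁻ x, treeSum q F (coeff lam σ f) x ^ p ∂ν) * ν univ ^ (p - 1) := by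
          simpa only [setLIntegral_univ] using rpow_setLIntegral_le hp.le
            (measurable_treeSum hF.measurableSet q (coeff lam σ f)).aemeasurable (μ := ν) univ
      _ ≤ C ^ p * J ^ (p / r) * ν univ ^ (p - 1) := by
          gcongr
          exact hfr ▸ hC f hfm (hfr ▸ hJtop)
      _ = (C * ν univ ^ (1 / p.conjExponent) * J ^ (1 / r)) ^ p := by
          simp only [ENNReal.mul_rpow_of_nonneg _ _ hpc.nonneg, ← ENNReal.rpow_mul,
            one_div_mul_eq_div, hpc.div_conj_eq_sub_one]
          ring
  refine (le_rpow_of_le_mul_rpow hrc hJtop hself).trans_eq ?_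
  rw [ENNReal.mul_rpow_of_nonneg _ _ hrc.nonneg, ← ENNReal.rpow_mul, one_div_mul_eq_div]

end Duality

section Necessity

variable {d : ℕ} {D 𝒬 : Set (Set (Fin d → ℝ))} {τ : 𝒬 → ℝ≥0} {σ w : (Fin d → ℝ) → ℝ}
  {p q r s : ℝ} {Q : Set (Fin d → ℝ)} {a : 𝒬 → (Fin d → ℝ) → ℝ} {C : ℝ≥0∞}

lemma MemB.tsum_rpow_le_one (ha : MemB s a) (hs : 0 < s) : ∀ᵐ y, ∑' R : 𝒬, ‖a R y‖ₑ ^ s ≤ 1 := by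
  filter_upwards [ha.norm_eq_one] with y hy
  by_cases hmem : y ∈ ⋃₀ 𝒬
  · rw [← rpow_one_div_rpow hs.ne' (∑' R : 𝒬, ‖a R y‖ₑ ^ s), hy hmem, ENNReal.one_rpow]
  · have h0 : ∀ R : 𝒬, a R y = 0 := fun R =>
      Function.notMem_support.1 fun h => hmem ⟨R, R.2, ha.support_subset R h⟩
    simp [h0, hs]

lemma MemB.exists_isSubunitSeq (ha : MemB q.conjExponent a) (hq : 1 < q) (h : IsNestedGrid 𝒬) :
    ∃ b : Set (Fin d → ℝ) → (Fin d → ℝ) → ℝ≥0∞,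
      (∀ R : 𝒬, Measurable (b R) ∧ b R =ᵐ[volume] (‖a R ·‖ₑ)) ∧
      ∀ F : Finset (Set (Fin d → ℝ)), (F : Set (Set (Fin d → ℝ))) ⊆ 𝒬 → IsSubunitSeq q F b := by
  have hq' := (Real.HolderConjugate.conjExponent hq).symm.pos
  have := h.countable.to_subtype
  choose g hg hag using fun R => (ha.aemeasurable R).enorm
  let E : Set (Fin d → ℝ) := {x | ∑' R, g R x ^ q.conjExponent ≤ 1}
  have hE : MeasurableSet E :=
    measurableSet_le (Measurable.tsum fun R => (hg R).pow_const _) measurable_const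
  have hEae : ∀ᵐ x, x ∈ E := by
    filter_upwards [ha.tsum_rpow_le_one hq', ae_all_iff.2 hag] with x hx hgx
    simpa only [E, mem_ofPred_eq, hgx] using hx
  let b : Set (Fin d → ℝ) → (Fin d → ℝ) → ℝ≥0∞ := Function.extend Subtype.val
    (fun R : 𝒬 => (E ∩ R).indicator (g R)) 0
  have hb : ∀ R : 𝒬, b R = (E ∩ R).indicator (g R) := Subtype.val_injective.extend_apply _ _
  have hbm : ∀ R : 𝒬, Measurable (b R) := fun R => by
    rw [hb]
    exact (hg R).indicator (hE.inter (h.measurableSet R R.2))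
  refine ⟨b, fun R => ⟨hbm R, ?_⟩, fun F hF => ⟨fun R hR => hbm ⟨R, hF hR⟩, fun R hR => ?_,
    fun x => ?_⟩⟩
  · filter_upwards [hEae, hag R] with x hx hgx
    rw [hb, hgx]
    by_cases hxR : x ∈ (R : Set (Fin d → ℝ))
    · exact indicator_of_mem (mem_inter hx hxR) _
    · rw [indicator_of_notMem (notMem_subset inter_subset_right hxR), ← hgx, eq_comm, enorm_eq_zero]
      exact Function.notMem_support.1 fun h => hxR (ha.support_subset R h)
  · rw [hb ⟨R, hF hR⟩]
    exact support_indicator_subset.trans inter_subset_right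
  · refine (sum_le_tsum_coe (fun R => b R x ^ q.conjExponent) hF).trans ?_
    by_cases hx : x ∈ E
    · refine (ENNReal.tsum_le_tsum fun R => ?_).trans hx
      rw [hb]
      exact ENNReal.rpow_le_rpow (indicator_le_self _ _ x) hq'.le
    · simp [hb, hx, hq']

lemma rpow_neg_mul_le_iff {a b c : ℝ≥0∞} (ha : a ≠ 0) (ha' : a ≠ ∞) (s : ℝ) :
    a ^ (-s) * b ≤ c ↔ b ≤ c * a ^ s := by
  have h0 : a ^ s ≠ 0 := (ENNReal.rpow_pos (pos_iff_ne_zero.2 ha) ha').ne'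
  have ht : a ^ s ≠ ∞ := by simp [ENNReal.rpow_eq_top_iff, ha, ha']
  rw [ENNReal.rpow_neg, mul_comm, ← div_eq_mul_inv,
    ENNReal.div_le_iff_le_mul (Or.inl h0) (Or.inl ht)]

lemma BoundedBy.directTesting_le (hC : BoundedBy r p q τ σ w C) (hD : IsNestedGrid D)
    (hσ : IsWeight σ) (hr : 0 < r) (hp : 0 < p) :
    directTesting r p q D τ σ w ^ (1 / p) ≤ C := by
  rw [one_div, ENNReal.rpow_inv_le_iff hp]
  refine iSup₂_le fun Q hQ => ?_
  have hQm := hD.measurableSet Q hQ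
  rw [rpow_neg_mul_le_iff (hD.wMeasure_ne_zero hσ hQ) (hD.wMeasure_ne_top hσ hQ)]
  have hmem : MemLp (Q.indicator fun _ => (1 : ℝ)) (ENNReal.ofReal r) (wMeasure σ) :=
    memLp_indicator_const _ hQm _ (Or.inr (hD.wMeasure_ne_top hσ hQ))
  have hnorm : ∫⁻ x, ‖Q.indicator (fun _ => (1 : ℝ)) x‖ₑ ^ r ∂(wMeasure σ) = wMeasure σ Q := by
    rw [← lintegral_indicator_one hQm]
    refine lintegral_congr fun x => ?_
    by_cases hx : x ∈ Q <;> simp [hx, hr]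
  exact (setLIntegral_le_lintegral _ _).trans
    (hnorm ▸ (eLpNorm_ofReal_le_mul_iff hp hr C).1 (hC _ hmem))

lemma BoundedBy.lintegral_dualMajorant_rpow_le (hC : BoundedBy r p q τ σ w C)
    (h : IsNestedGrid 𝒬) (hσ : IsWeight σ) (hr : 1 < r) (hp : 1 < p) (hq : 1 < q)
    (hw : wMeasure w Q ≠ ∞) (ha : MemB q.conjExponent a) :
    ∫⁻ x, dualMajorant τ w Q a x ^ r.conjExponent ∂(wMeasure σ) ≤
      C ^ r.conjExponent * wMeasure w Q ^ (r.conjExponent / p.conjExponent) := by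
  obtain ⟨b, hb, hbF⟩ := ha.exists_isSubunitSeq hq h
  have hr' := (Real.HolderConjugate.conjExponent hr).symm.pos
  calc ∫⁻ x, dualMajorant τ w Q a x ^ r.conjExponent ∂(wMeasure σ)
      ≤ ∫⁻ x, (∑' R : 𝒬, (R : Set (Fin d → ℝ)).indicator
          (fun _ => avgCoeff τ R * ∫⁻ y in Q, b R y ∂(wMeasure w)) x) ^ r.conjExponent
          ∂(wMeasure σ) := by
        refine lintegral_mono fun x => ENNReal.rpow_le_rpow (ENNReal.tsum_le_tsum fun R =>
          indicator_le_indicator (mul_le_mul_right ?_ _)) hr'.le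
        refine (lintegral_mono_set inter_subset_left).trans_eq (lintegral_congr_ae ?_)
        exact ae_restrict_of_ae ((wMeasure_absolutelyContinuous w).ae_le (hb R).2.symm)
    _ ≤ C ^ r.conjExponent * wMeasure w Q ^ (r.conjExponent / p.conjExponent) := by
        refine lintegral_tsum_coe_rpow_le
          (g := fun R => R.indicator fun _ => avgCoeff τ R * ∫⁻ y in Q, b R y ∂(wMeasure w))
          h.countable (fun R hR => measurable_const.indicator (h.measurableSet R hR)) hr'
          fun F hF => ?_
        simpa only [Measure.restrict_apply_univ, dualSum] using
          (h.mono hF).toIsNestedFamily.lintegral_dualSum_rpow_le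
            (ν := (wMeasure w).restrict Q) (C := C)
            (fun R hR => h.wMeasure_ne_top hσ (hF hR))
            (by rwa [Measure.restrict_apply_univ]) (fun R hR => h.avgCoeff_ne_top τ (hF hR))
            hr hp hq (fun f hf hfr => (setLIntegral_le_lintegral _ _).trans
              (hC.lintegral_treeSum_rpow_le h hσ hr (one_pos.trans hp) (one_pos.trans hq) hF hf
                hfr))
            (hbF F hF)

lemma BoundedBy.dualTesting_le (hC : BoundedBy r p q τ σ w C) (hD : IsNestedGrid D) (h𝒬 : 𝒬 ⊆ D)
    (hσ : IsWeight σ) (hw : IsWeight w) (hr : 1 < r) (hp : 1 < p) (hq : 1 < q) :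
    dualTesting r p q D τ σ w ^ (1 / r.conjExponent) ≤ C := by
  have hr' := (Real.HolderConjugate.conjExponent hr).symm.pos
  rw [one_div, ENNReal.rpow_inv_le_iff hr']
  refine iSup₂_le fun Q hQ => iSup₂_le fun a ha => ?_
  have hwQ := hD.wMeasure_ne_top hw hQ
  rw [rpow_neg_mul_le_iff (hD.wMeasure_ne_zero hw hQ) hwQ]
  refine (setLIntegral_le_lintegral _ _).trans ((lintegral_mono fun x => ?_).trans
    (hC.lintegral_dualMajorant_rpow_le (hD.mono h𝒬) hσ hr hp hq hwQ ha))
  exact ENNReal.rpow_le_rpow ((hD.mono h𝒬).absU_le_dualMajorant hw (hD.measurableSet Q hQ)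
    ha.aemeasurable) hr'.le

end Necessity

section Extension

variable {X : Type*} [MeasurableSpace X] {S : Set (Set X)}

lemma exists_measurable_tsum_eq_one (hS : S.Countable) (hm : ∀ R ∈ S, MeasurableSet R) :
    ∃ φ : S → X → ℝ≥0∞, (∀ R, Measurable (φ R)) ∧ (∀ R, Function.support (φ R) ⊆ R) ∧
      ∀ x ∈ ⋃₀ S, ∑' R, φ R x = 1 := by
  have := hS.to_subtype
  obtain ⟨ε, hε, hε1⟩ := ENNReal.exists_pos_sum_of_countable one_ne_zero S
  let i : S → X → ℝ≥0∞ := fun R => (R : Set X).indicator fun _ => (ε R : ℝ≥0∞)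
  let Z : X → ℝ≥0∞ := fun x => ∑' R, i R x
  have hi : ∀ R, Measurable (i R) := fun R => measurable_const.indicator (hm R R.2)
  refine ⟨fun R x => i R x / Z x, fun R => (hi R).div (Measurable.tsum hi), fun R => ?_, ?_⟩
  · refine Function.support_subset_iff'.2 fun x hx => ?_
    simp [i, hx]
  · rintro x ⟨R, hR, hxR⟩
    have hZ0 : Z x ≠ 0 := fun h0 => by
      have hRx := ENNReal.tsum_eq_zero.1 h0 ⟨R, hR⟩
      simp [i, hxR, (hε ⟨R, hR⟩).ne'] at hRx
    have hZtop : Z x ≠ ∞ :=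
      ne_top_of_le_ne_top hε1.ne_top (ENNReal.tsum_le_tsum fun R => indicator_le_self _ _ x)
    simp_rw [div_eq_mul_inv]
    rw [ENNReal.tsum_mul_right, ENNReal.mul_inv_cancel hZ0 hZtop]

variable {d : ℕ} {𝒬 : Set (Set (Fin d → ℝ))} {q s : ℝ}

lemma exists_memB_enorm_eq (hs : 0 < s) {g : 𝒬 → (Fin d → ℝ) → ℝ≥0∞} (hg : ∀ R, Measurable (g R))
    (hsupp : ∀ R : 𝒬, Function.support (g R) ⊆ (R : Set (Fin d → ℝ)))
    (hg1 : ∀ x ∈ ⋃₀ 𝒬, ∑' R, g R x = 1) :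
    ∃ b : 𝒬 → (Fin d → ℝ) → ℝ, MemB s b ∧ (∀ R x, 0 ≤ b R x) ∧
      ∀ R x, ‖b R x‖ₑ = g R x ^ (1 / s) := by
  have hgtop : ∀ R x, g R x ≠ ∞ := fun R x htop => by
    have hx : x ∈ (R : Set (Fin d → ℝ)) := hsupp R (by simp [htop])
    have hle := ENNReal.le_tsum (f := fun R => g R x) R
    simp [hg1 x ⟨R, R.2, hx⟩, htop] at hle
  have hb : ∀ R x, ‖(g R x ^ (1 / s)).toReal‖ₑ = g R x ^ (1 / s) := fun R x =>
    Real.enorm_toReal (ENNReal.rpow_ne_top_of_nonneg (one_div_nonneg.2 hs.le) (hgtop R x))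
  refine ⟨fun R x => (g R x ^ (1 / s)).toReal,
    ⟨fun R => ?_, ?_, fun R x hx => hsupp R fun h0 => ?_⟩,
    fun _ _ => ENNReal.toReal_nonneg, hb⟩
  · exact ((hg R).pow_const _).ennreal_toReal.aemeasurable
  · refine Filter.Eventually.of_forall fun x hx => ?_
    simp_rw [hb, rpow_one_div_rpow hs.ne', hg1 x hx, ENNReal.one_rpow]
  · simp [h0, hs] at hx

lemma IsSubunitSeq.exists_memB_ge {G : Finset (Set (Fin d → ℝ))}
    {a : Set (Fin d → ℝ) → (Fin d → ℝ) → ℝ≥0∞} (ha : IsSubunitSeq q G a) (hq : 1 < q)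
    (hG : (G : Set (Set (Fin d → ℝ))) ⊆ 𝒬) (h : IsNestedGrid 𝒬) :
    ∃ b : 𝒬 → (Fin d → ℝ) → ℝ, MemB q.conjExponent b ∧ (∀ R x, 0 ≤ b R x) ∧
      ∀ R : 𝒬, (R : Set (Fin d → ℝ)) ∈ G → ∀ x, a R x ≤ ‖b R x‖ₑ := by
  classical
  set s := q.conjExponent
  have hs : 0 < s := (Real.HolderConjugate.conjExponent hq).symm.pos
  obtain ⟨φ, hφ, hφsupp, hφ1⟩ := exists_measurable_tsum_eq_one h.countable h.measurableSet
  let α : 𝒬 → (Fin d → ℝ) → ℝ≥0∞ := fun R x =>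
    if (R : Set (Fin d → ℝ)) ∈ G then a R x ^ s else 0
  let S : (Fin d → ℝ) → ℝ≥0∞ := fun x => ∑ R ∈ G, a R x ^ s
  have hS : Measurable S := Finset.measurable_fun_sum _ fun R hR => (ha.measurable R hR).pow_const s
  have hα : ∀ R, Measurable (α R) := fun R => by
    by_cases hR : (R : Set (Fin d → ℝ)) ∈ G
    · simpa only [α, hR, if_true] using (ha.measurable R hR).pow_const s
    · simpa only [α, hR, if_false] using measurable_const
  have hαsupp : ∀ R : 𝒬, Function.support (α R) ⊆ R := fun R x hx => by
    by_cases hR : (R : Set (Fin d → ℝ)) ∈ G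
    · refine ha.support_subset R hR fun h0 => ?_
      simp [α, hR, h0, hs] at hx
    · simp [α, hR] at hx
  obtain ⟨b, hb, hb0, hbg⟩ := exists_memB_enorm_eq hs
    (g := fun R x => α R x + (1 - S x) * φ R x)
    (fun R => (hα R).add ((measurable_const.sub hS).mul (hφ R)))
    (fun R => Function.support_subset_iff'.2 fun x hx => by
      simp [Function.support_subset_iff'.1 (hαsupp R) x hx,
        Function.support_subset_iff'.1 (hφsupp R) x hx])
    (fun x hx => by
      have hαS : ∑' R, α R x = S x := tsum_coe_ite (fun R => a R x ^ s) hG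
      rw [ENNReal.tsum_add, ENNReal.tsum_mul_left, hφ1 x hx, mul_one, hαS]
      exact add_tsub_cancel_of_le (ha.sum_rpow_le_one x))
  refine ⟨b, hb, hb0, fun R hR x => ?_⟩
  rw [hbg, one_div, ENNReal.le_rpow_inv_iff hs]
  simp only [α, hR, if_true, le_self_add]

end Extension

section Sufficiency

variable {d : ℕ} {D 𝒬 : Set (Set (Fin d → ℝ))} {τ : 𝒬 → ℝ≥0} {σ w : (Fin d → ℝ) → ℝ}
  {p q r s : ℝ} {F : Finset (Set (Fin d → ℝ))} {Q : Set (Fin d → ℝ)}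
  {a : 𝒬 → (Fin d → ℝ) → ℝ}

lemma MemB.setLIntegral_enorm_ne_top (ha : MemB s a) (hs : 0 < s)
    (hQ : wMeasure w Q ≠ ∞) (R : 𝒬) : ∫⁻ y in Q, ‖a R y‖ₑ ∂(wMeasure w) ≠ ∞ := by
  have hle : ∀ᵐ y ∂(wMeasure w), ‖a R y‖ₑ ≤ 1 := by
    filter_upwards [(wMeasure_absolutelyContinuous w).ae_le (ha.tsum_rpow_le_one hs)] with y hy
    rw [← ENNReal.rpow_le_rpow_iff hs, ENNReal.one_rpow]
    exact (ENNReal.le_tsum (f := fun R : 𝒬 => ‖a R y‖ₑ ^ s) R).trans hy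
  refine ne_top_of_le_ne_top hQ ((lintegral_mono_ae (ae_restrict_of_ae hle)).trans_eq ?_)
  exact setLIntegral_one Q

lemma setLIntegral_enorm_indicator_one {X : Type*} [MeasurableSpace X] {μ : Measure X} {Q : Set X}
    (hQ : MeasurableSet Q) (R : Set X) :
    ∫⁻ y in R, ‖Q.indicator (fun _ => (1 : ℝ)) y‖ₑ ∂μ = μ (Q ∩ R) := by
  simp_rw [enorm_indicator_eq_indicator_enorm, enorm_one]
  rw [setLIntegral_indicator hQ, setLIntegral_one]

lemma IsNestedGrid.directTest (hD : IsNestedGrid D) (h𝒬 : 𝒬 ⊆ D) (hσ : IsWeight σ) (hp : 0 < p)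
    (hq : 0 < q) (hF : (F : Set (Set (Fin d → ℝ))) ⊆ 𝒬) :
    DirectTest F (avgCoeff τ) (wMeasure σ) (wMeasure w) p q r
      (directTesting r p q D τ σ w) := by
  intro Q hQ
  have hQD : Q ∈ D := h𝒬 (hF hQ)
  have hQm := hD.measurableSet Q hQD
  have htest := le_iSup₂ (f := fun Q (_ : Q ∈ D) => wMeasure σ Q ^ (-(p / r)) *
      ∫⁻ x in Q, Tbar q τ σ (Q.indicator fun _ => 1) x ^ p ∂(wMeasure w)) Q hQD
  rw [rpow_neg_mul_le_iff (hD.wMeasure_ne_zero hσ hQD) (hD.wMeasure_ne_top hσ hQD)] at htest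
  refine (lintegral_mono fun x => ENNReal.rpow_le_rpow ?_ hp.le).trans htest
  refine le_of_eq_of_le ?_ ((hD.mono h𝒬).treeSum_le_Tbar hσ
    (measurable_const.indicator hQm).aemeasurable
    (indicator_nonneg fun _ _ => zero_le_one) (fun R hR => ?_) hq
    ((Finset.coe_subset.2 (subtree_subset F Q)).trans hF))
  · refine congrArg (· ^ (1 / q)) (Finset.sum_congr rfl fun R hR => ?_)
    rw [coeff, setLIntegral_enorm_indicator_one hQm,
      inter_eq_self_of_subset_right (mem_subtree.1 hR).2]
  · rw [setLIntegral_enorm_indicator_one hQm]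
    exact ne_top_of_le_ne_top (hD.wMeasure_ne_top hσ (h𝒬 hR)) (measure_mono inter_subset_right)

lemma dualSum_subtree_le_dualMajorant {b : Set (Fin d → ℝ) → (Fin d → ℝ) → ℝ≥0∞}
    {G : Finset (Set (Fin d → ℝ))} (hG : (G : Set (Set (Fin d → ℝ))) ⊆ 𝒬)
    (hGQ : ∀ R ∈ G, R ⊆ Q) (hb : ∀ R ∈ G, Function.support (b R) ⊆ R)
    (hba : ∀ R : 𝒬, (R : Set (Fin d → ℝ)) ∈ G → ∀ x, b R x ≤ ‖a R x‖ₑ) (x : Fin d → ℝ) :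
    dualSum G (avgCoeff τ) (wMeasure w) b x ≤ dualMajorant τ w Q a x := by
  classical
  rw [dualSum, dualMajorant, ← tsum_coe_ite _ hG]
  refine ENNReal.tsum_le_tsum fun R => ?_
  split_ifs with hR
  · refine indicator_le_indicator (mul_le_mul_right ?_ _)
    rw [inter_eq_self_of_subset_right (hGQ R hR),
      ← setLIntegral_eq_of_support_subset (hb R hR)]
    exact lintegral_mono (hba R hR)
  · exact zero_le

lemma IsNestedGrid.dualTest (hD : IsNestedGrid D) (h𝒬 : 𝒬 ⊆ D) (hw : IsWeight w) (hr : 1 < r)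
    (hq : 1 < q) (hF : (F : Set (Set (Fin d → ℝ))) ⊆ 𝒬) :
    DualTest F (avgCoeff τ) (wMeasure σ) (wMeasure w) p q r (dualTesting r p q D τ σ w) := by
  intro Q hQ a ha
  have hQD : Q ∈ D := h𝒬 (hF hQ)
  have hQm := hD.measurableSet Q hQD
  have hsub : (subtree F Q : Set (Set (Fin d → ℝ))) ⊆ 𝒬 :=
    (Finset.coe_subset.2 (subtree_subset F Q)).trans hF
  obtain ⟨b, hb, hb0, hab⟩ := ha.exists_memB_ge hq hsub (hD.mono h𝒬)
  have htest : wMeasure w Q ^ (-(r.conjExponent / p.conjExponent)) *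
      ∫⁻ x in Q, absU τ (fun R => (Q ∩ (R : Set (Fin d → ℝ))).indicator fun y => b R y * w y) x
        ^ r.conjExponent ∂(wMeasure σ) ≤ dualTesting r p q D τ σ w := by
    unfold dualTesting
    exact le_iSup₂_of_le Q hQD (le_iSup₂_of_le b hb le_rfl)
  rw [rpow_neg_mul_le_iff (hD.wMeasure_ne_zero hw hQD) (hD.wMeasure_ne_top hw hQD)] at htest
  refine (lintegral_mono fun x => ENNReal.rpow_le_rpow ?_
    (Real.HolderConjugate.conjExponent hr).symm.nonneg).trans htest
  refine (dualSum_subtree_le_dualMajorant hsub (fun R hR => (mem_subtree.1 hR).2) ha.support_subset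
    hab x).trans
      ((hD.mono h𝒬).dualMajorant_le_absU hw hQm hb.aemeasurable hb0 fun R => ?_)
  refine ne_top_of_le_ne_top (hb.setLIntegral_enorm_ne_top
    (Real.HolderConjugate.conjExponent hq).symm.pos (hD.wMeasure_ne_top hw (h𝒬 R.2)) R)
    (lintegral_mono fun y => ?_)
  rw [enorm_indicator_eq_indicator_enorm]
  exact indicator_le_self _ _ y

/-- The constant in the upper bound for the operator norm. -/
noncomputable def normConst (p r : ℝ) : ℝ≥0∞ := (2 * twoWeightConst p r) ^ (1 / p)

lemma normConst_ne_top (hr : 1 < r) (hrp : r ≤ p) : normConst p r ≠ ∞ :=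
  ENNReal.rpow_ne_top_of_nonneg (one_div_nonneg.2 (by linarith))
    (ENNReal.mul_ne_top (by simp) (twoWeightConst_ne_top hr hrp))

lemma IsNestedGrid.boundedBy_normConst_mul (hD : IsNestedGrid D) (h𝒬 : 𝒬 ⊆ D) (hσ : IsWeight σ)
    (hw : IsWeight w) (hr : 1 < r) (hrp : r ≤ p) (hq : 1 < q) :
    BoundedBy r p q τ σ w (normConst p r * max (dualTesting r p q D τ σ w ^ (1 / r.conjExponent))
      (directTesting r p q D τ σ w ^ (1 / p))) := by
  have hr0 : 0 < r := by linarith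
  have hp0 : 0 < p := by linarith
  have hq0 : 0 < q := by linarith
  set L := dualTesting r p q D τ σ w
  set A := directTesting r p q D τ σ w
  set M := max (L ^ (1 / r.conjExponent)) (A ^ (1 / p))
  have hL : L ^ (p / r.conjExponent) ≤ M ^ p := by
    rw [← one_div_mul_eq_div, ENNReal.rpow_mul]
    exact ENNReal.rpow_le_rpow (le_max_left _ _) hp0.le
  have hA : A ≤ M ^ p := by
    rw [← rpow_one_div_rpow hp0.ne' A]
    exact ENNReal.rpow_le_rpow (le_max_right _ _) hp0.le
  refine (hD.mono h𝒬).boundedBy_of_lintegral_treeSum_rpow_le hσ hr0 hp0 hq0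
    fun F hF f hf hfr => ?_
  calc ∫⁻ x, treeSum q F (coeff (avgCoeff τ) (wMeasure σ) f) x ^ p ∂(wMeasure w)
      ≤ twoWeightConst p r * (L ^ (p / r.conjExponent) + A) *
          (∫⁻ x, f x ^ r ∂(wMeasure σ)) ^ (p / r) :=
        (hD.mono (hF.trans h𝒬)).toIsNestedFamily.lintegral_treeSum_coeff_rpow_le
          (fun R hR => hD.wMeasure_ne_top hσ (h𝒬 (hF hR)))
          (fun R hR => hD.wMeasure_ne_top hw (h𝒬 (hF hR)))
          (fun R hR => (hD.mono h𝒬).avgCoeff_ne_top τ (hF hR)) hr hrp hq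
          (hD.directTest h𝒬 hσ hp0 hq0 hF) (hD.dualTest h𝒬 hw hr hq hF) hf hfr
    _ ≤ twoWeightConst p r * (M ^ p + M ^ p) * (∫⁻ x, f x ^ r ∂(wMeasure σ)) ^ (p / r) := by
        gcongr
    _ = (normConst p r * M) ^ p * (∫⁻ x, f x ^ r ∂(wMeasure σ)) ^ (p / r) := by
        rw [ENNReal.mul_rpow_of_nonneg _ _ hp0.le, normConst, rpow_one_div_rpow hp0.ne']
        ring

end Sufficiency

section Characterization

variable {d : ℕ} {D 𝒬 : Set (Set (Fin d → ℝ))} {τ : 𝒬 → ℝ≥0} {σ w : (Fin d → ℝ) → ℝ}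
  {p q r : ℝ} {C : ℝ≥0∞}

lemma BoundedBy.max_testing_le (hC : BoundedBy r p q τ σ w C) (hD : IsNestedGrid D) (h𝒬 : 𝒬 ⊆ D)
    (hσ : IsWeight σ) (hw : IsWeight w) (hr : 1 < r) (hp : 1 < p) (hq : 1 < q) :
    max (dualTesting r p q D τ σ w ^ (1 / r.conjExponent))
      (directTesting r p q D τ σ w ^ (1 / p)) ≤ C :=
  max_le (hC.dualTesting_le hD h𝒬 hσ hw hr hp hq)
    (hC.directTesting_le hD hσ (one_pos.trans hr) (one_pos.trans hp))

lemma max_testing_lt_top_iff (hr : 1 < r) (hp : 0 < p) :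
    max (dualTesting r p q D τ σ w ^ (1 / r.conjExponent))
        (directTesting r p q D τ σ w ^ (1 / p)) < ∞ ↔
      dualTesting r p q D τ σ w < ∞ ∧ directTesting r p q D τ σ w < ∞ := by
  have hr' := (Real.HolderConjugate.conjExponent hr).symm.pos
  rw [max_lt_iff, ENNReal.rpow_lt_top_iff_of_pos (one_div_pos.2 hr'),
    ENNReal.rpow_lt_top_iff_of_pos (one_div_pos.2 hp)]

end Characterization

end VectorDyadic

open VectorDyadic in
theorem theorem1_general (r p : ℝ) (hr : 1 < r) (hrp : r ≤ p) :
    ∃ K : ℝ≥0, 0 < K ∧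
      ∀ (d : ℕ) (q : ℝ), 1 < q → ∀ D : Set (Set (Fin d → ℝ)), IsNestedGrid D → ∀ 𝒬 ⊆ D,
      ∀ (τ : 𝒬 → ℝ≥0) (σ w : (Fin d → ℝ) → ℝ), IsWeight σ → IsWeight w →
        (IsBoundedOp r p q τ σ w ↔
          dualTesting r p q D τ σ w < ∞ ∧ directTesting r p q D τ σ w < ∞) ∧
        opNorm r p q τ σ w ≤ K * max (dualTesting r p q D τ σ w ^ (1 / r.conjExponent))
          (directTesting r p q D τ σ w ^ (1 / p)) ∧
        max (dualTesting r p q D τ σ w ^ (1 / r.conjExponent))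
          (directTesting r p q D τ σ w ^ (1 / p)) ≤ K * opNorm r p q τ σ w := by
  have hN := normConst_ne_top hr hrp
  refine ⟨max 1 (normConst p r).toNNReal, lt_max_of_lt_left one_pos,
    fun d q hq D hD 𝒬 h𝒬 τ σ w hσ hw => ?_⟩
  have hupper := hD.boundedBy_normConst_mul (τ := τ) h𝒬 hσ hw hr hrp hq
  have hlower := fun C (hC : BoundedBy r p q τ σ w C) =>
    hC.max_testing_le hD h𝒬 hσ hw hr (hr.trans_le hrp) hq
  rw [← max_testing_lt_top_iff hr (by linarith)]
  set M := max (dualTesting r p q D τ σ w ^ (1 / r.conjExponent))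
    (directTesting r p q D τ σ w ^ (1 / p))
  refine ⟨⟨fun ⟨C, hC⟩ => (hlower C hC).trans_lt ENNReal.coe_lt_top, fun hM =>
    ⟨(normConst p r * M).toNNReal, ?_⟩⟩, (sInf_le hupper).trans ?_, (le_sInf hlower).trans ?_⟩
  · rwa [ENNReal.coe_toNNReal (ENNReal.mul_ne_top hN hM.ne)]
  · gcongr
    exact (ENNReal.coe_toNNReal hN).ge.trans (ENNReal.coe_le_coe.2 (le_max_right _ _))
  · exact le_mul_of_one_le_left zero_le (ENNReal.coe_le_coe.2 (le_max_left _ _))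

theorem theorem1 (d : ℕ) (r p q : ℝ) (hr : 1 < r) (hrp : r ≤ p) (hq : 1 < q) :
    ∃ K : NNReal, 0 < K ∧
      ∀ (D : Set (Set (Fin d → ℝ))), VectorDyadic.IsDyadicGrid D →
      ∀ (𝒬 : Set (Set (Fin d → ℝ))), 𝒬 ⊆ D →
      ∀ (τ : 𝒬 → NNReal) (σ w : (Fin d → ℝ) → ℝ),
        VectorDyadic.IsWeight σ → VectorDyadic.IsWeight w →
        (VectorDyadic.IsBoundedOp r p q τ σ w ↔
          VectorDyadic.dualTesting r p q D τ σ w < ∞ ∧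
          VectorDyadic.directTesting r p q D τ σ w < ∞) ∧
        VectorDyadic.opNorm r p q τ σ w ≤
          K * max (VectorDyadic.dualTesting r p q D τ σ w ^ (1 / r.conjExponent))
            (VectorDyadic.directTesting r p q D τ σ w ^ (1 / p)) ∧
        max (VectorDyadic.dualTesting r p q D τ σ w ^ (1 / r.conjExponent))
            (VectorDyadic.directTesting r p q D τ σ w ^ (1 / p)) ≤
          K * VectorDyadic.opNorm r p q τ σ w := by
  obtain ⟨K, hK, hmain⟩ := theorem1_general r p hr hrp
  exact ⟨K, hK, fun D hD => hmain d q hq D hD.isNestedGrid⟩
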